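/- **Conventions.** Let $(V,\omega)$ be a finite-dimensional real symplectic vector space, endowed with a positive definite inner product $\langle\cdot,\cdot\rangle$ and a complex structure $J$ ($J^2=-\mathrm{Id}$) such that $\langle J\cdot,\cdot\rangle=\omega$; $\mathrm{Sp}(V,\omega)\subset \mathrm{GL}(V)$ is the symplectic group. For a symmetric bilinear form $B$, let $\mathrm{sign}(B)=n_-(B)-n_+(B)$, where $n_\mp(B)$ is the maximal dimension of a subspace on which $B$ is negative, resp. positive, definite; a symmetric operator $A$ of $V$ is identified with the form $\langle A\cdot,\cdot\rangle$. For a symplectic space $(E,\sigma)$, let $\Lambda(E,\sigma)$ be the space of its Lagrangian subspaces. If $L_0,L,L_1\in\Lambda(E,\sigma)$ with $L_0$ and $L$ transverse to $L_1$, let $\varphi_{L_0,L_1}(L)$ be the symmetric bilinear form $\sigma(T\cdot,\cdot)$ on $L_0$, where $L$ is the graph of $T:L_0\to L_1$. The $L_0$-Maslov index $\mu_{L_0}$ is the unique $\frac12\mathbb Z$-valued function on continuous paths in $\Lambda(E,\sigma)$ that is invariant under fixed-endpoint homotopies, additive under concatenation, and satisfies $\mu_{L_0}(\gamma)=\frac12\mathrm{sign}\,\varphi_{L_0,L_1}(\gamma(1))-\frac12\mathrm{sign}\,\varphi_{L_0,L_1}(\gamma(0))$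 for every $L_1$ transverse to $L_0$ and every continuous $\gamma:[0,1]\to\Lambda(E,\sigma)$ whose values are all transverse to $L_1$. The Conley–Zehnder index of a continuous path $\Phi:[0,1]\to\mathrm{Sp}(V,\omega)$ is $\mathfrak i_{\mathrm{CZ}}(\Phi)=\mu_\Delta\big(t\mapsto\mathrm{Gr}(\Phi(t))\big)$, the Maslov index in $(V\oplus V,\omega\oplus(-\omega))$ relative to the diagonal $\Delta$, where $\mathrm{Gr}(\phi)=\{(v,\phi v):v\in V\}$. For $\phi\in\mathrm{Sp}(V,\omega)$ with $\mathrm{Id}-\phi$ invertible, the symplectic Cayley transform is the symmetric operator $M_\phi=\frac12J(\mathrm{Id}+\phi)(\mathrm{Id}-\phi)^{-1}$. **Statement.** Let $\Phi_1,\Phi_2:[0,1]\to\mathrm{Sp}(V,\omega)$ be continuous paths with $\Phi_1(0)=\Phi_2(0)=\mathrm{Id}$ and with $\mathrm{Id}-\Phi_1(1)$, $\mathrm{Id}-\Phi_2(1)$ invertible. Then, for the pointwise products, $$\mathfrak i_{\mathrm{CZ}}(\Phi_1\Phi_2)=\mathfrak i_{\mathrm{CZ}}(\Phi_2\Phi_1)=\mathfrak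 i_{\mathrm{CZ}}(\Phi_1)+\mathfrak i_{\mathrm{CZ}}(\Phi_2)+\tfrac12\,\mathrm{sign}\big(M_{\Phi_1(1)}+M_{\Phi_2(1)}\big).$$ -/

import Mathlib

noncomputable section

/-- The signature of a symmetric bilinear form `B` on a finite dimensional real vector space, with
the sign convention `sign B = n₋(B) - n₊(B)` (index minus coindex), where `n₋(B)`, `n₊(B)` are the
maximal dimensions of subspaces on which `B` is negative, resp. positive, definite. -/
def formSign {E : Type*} [AddCommGroup E] [Module ℝ E] (B : LinearMap.BilinForm ℝ E) : ℤ :=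
  (sigNeg B.toQuadraticMap : ℤ) - (sigPos B.toQuadraticMap : ℤ)

/-- A Lagrangian subspace of `(E, ω)`: `ω` vanishes on it and its dimension is half that of `E`. -/
structure IsLagrangian {E : Type*} [AddCommGroup E] [Module ℝ E] (ω : LinearMap.BilinForm ℝ E)
    (L : Submodule ℝ E) : Prop where
  isotropic : ∀ x ∈ L, ∀ y ∈ L, ω x y = 0
  finrank_eq : 2 * Module.finrank ℝ L = Module.finrank ℝ E

/-- The set `Λ(E, ω)` of Lagrangian subspaces. -/
abbrev LagrangianGrassmannian {E : Type*} [AddCommGroup E] [Module ℝ E]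
    (ω : LinearMap.BilinForm ℝ E) : Type _ :=
  {L : Submodule ℝ E // IsLagrangian ω L}

/-- If `L` and `L₁` are complementary, the linear map `T : L₀ → L₁` such that `x + T x ∈ L` for all
`x ∈ L₀`, i.e. minus the projection onto `L₁` along `L`, restricted to `L₀`.  If moreover `L₀` and
`L₁` are complementary, then `L` is the graph of `T`. -/
def graphMap {E : Type*} [AddCommGroup E] [Module ℝ E] (L₀ L₁ L : Submodule ℝ E)
    (h : IsCompl L L₁) : L₀ →ₗ[ℝ] L₁ :=
  -((L₁.projectionOnto L h.symm) ∘ₗ L₀.subtype)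

/-- `L` is the graph of `graphMap L₀ L₁ L`, and this determines the map. -/
theorem graphMap_spec {E : Type*} [AddCommGroup E] [Module ℝ E] {L₀ L₁ L : Submodule ℝ E}
    (h₀ : IsCompl L₀ L₁) (h : IsCompl L L₁) (T : L₀ →ₗ[ℝ] L₁) :
    (∀ z : E, z ∈ L ↔ ∃ x : L₀, z = (x : E) + (T x : E)) ↔ T = graphMap L₀ L₁ L h := by
  have key : ∀ (x : L₀) (y : L₁), (x : E) + (y : E) ∈ L ↔ y = graphMap L₀ L₁ L h x := by
    intro x y
    rw [← Submodule.projectionOnto_apply_eq_zero_iff h.symm, map_add,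
      Submodule.projectionOnto_apply_left]
    simp only [graphMap, LinearMap.neg_apply, LinearMap.comp_apply, Submodule.subtype_apply]
    rw [add_comm, add_eq_zero_iff_eq_neg]
  constructor
  · intro hT
    ext x
    exact congrArg Subtype.val ((key x (T x)).1 ((hT _).2 ⟨x, rfl⟩))
  · rintro rfl z
    constructor
    · intro hz
      have hz' : z ∈ L₀ ⊔ L₁ := by rw [h₀.sup_eq_top]; trivial
      obtain ⟨x, hx, y, hy, rfl⟩ := Submodule.mem_sup.1 hz'
      refine ⟨⟨x, hx⟩, ?_⟩
      rw [← (key ⟨x, hx⟩ ⟨y, hy⟩).1 hz]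
    · rintro ⟨x, rfl⟩
      exact (key x _).2 rfl

/-- The chart `φ_{L₀,L₁}` of the Lagrangian Grassmannian, on Lagrangians `L` transverse to `L₁`:
the bilinear form `ω(T ·, ·)` on `L₀`, where `L` is the graph of `T : L₀ → L₁`. -/
def lagrangianChart {E : Type*} [AddCommGroup E] [Module ℝ E] (ω : LinearMap.BilinForm ℝ E)
    (L₀ L₁ L : Submodule ℝ E) (h : IsCompl L L₁) : LinearMap.BilinForm ℝ L₀ :=
  ω.compl₁₂ (L₁.subtype ∘ₗ graphMap L₀ L₁ L h) L₀.subtype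

/-- `HasMaslovIndex ω L₀ γ r`: the value `r` is obtained for the `L₀`-Maslov index of `γ` by
cutting `[0,1]` into consecutive intervals `[t i, t (i+1)]` on each of which `γ` stays in the
domain of a chart `φ_{L₀, M i}`, where `M i` is a Lagrangian transverse to `L₀`, and adding up
`½ sign φ_{L₀, M i}(γ (t (i+1))) - ½ sign φ_{L₀, M i}(γ (t i))`.  This is the only value that
additivity under concatenation and the normalization of the Maslov index on paths that stay in
the domain of one chart `φ_{L₀, L₁}` allow. -/
def HasMaslovIndex {E : Type*} [AddCommGroup E] [Module ℝ E] (ω : LinearMap.BilinForm ℝ E)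
    (L₀ : LagrangianGrassmannian ω) (γ : unitInterval → LagrangianGrassmannian ω) (r : ℝ) : Prop :=
  ∃ (k : ℕ) (t : Fin (k + 1) → unitInterval) (M : Fin k → LagrangianGrassmannian ω)
    (ht : Monotone t) (_ : t 0 = 0) (_ : t (Fin.last k) = 1)
    (_ : ∀ i, IsCompl L₀.1 (M i).1)
    (hM : ∀ i, ∀ s ∈ Set.Icc (t i.castSucc) (t i.succ), IsCompl (γ s).1 (M i).1),
    r = ∑ i : Fin k,
      ((1 / 2 : ℝ) * (formSign (lagrangianChart ω L₀.1 (M i).1 (γ (t i.succ)).1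
          (hM i _ (Set.right_mem_Icc.2 (ht i.castSucc_lt_succ.le)))) : ℝ)
        - (1 / 2 : ℝ) * (formSign (lagrangianChart ω L₀.1 (M i).1 (γ (t i.castSucc)).1
          (hM i _ (Set.left_mem_Icc.2 (ht i.castSucc_lt_succ.le)))) : ℝ))

open Classical in
/-- The `L₀`-Maslov index of a path `γ : [0,1] → Λ(E, ω)`, a half-integer.  (For continuous `γ`
the value in `HasMaslovIndex` exists and does not depend on the choices.) -/
def maslovIndex {E : Type*} [AddCommGroup E] [Module ℝ E] (ω : LinearMap.BilinForm ℝ E)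
    (L₀ : LagrangianGrassmannian ω) (γ : unitInterval → LagrangianGrassmannian ω) : ℝ :=
  if h : ∃ r, HasMaslovIndex ω L₀ γ r then h.choose else 0

/-- The form `ω² = ω ⊕ (-ω)` on `V ⊕ V`. -/
def doubleForm {V : Type*} [AddCommGroup V] [Module ℝ V] (ω : LinearMap.BilinForm ℝ V) :
    LinearMap.BilinForm ℝ (V × V) :=
  ω.compl₁₂ (LinearMap.fst ℝ V V) (LinearMap.fst ℝ V V)
    - ω.compl₁₂ (LinearMap.snd ℝ V V) (LinearMap.snd ℝ V V)

/-- The symplectic group `Sp(V, ω)`, a subgroup of `GL(V)`, with the subspace topology. -/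
def Sp {V : Type*} [NormedAddCommGroup V] [NormedSpace ℝ V] (ω : LinearMap.BilinForm ℝ V) :
    Subgroup (V →L[ℝ] V)ˣ where
  carrier := {A | ∀ v w, ω ((A : V →L[ℝ] V) v) ((A : V →L[ℝ] V) w) = ω v w}
  mul_mem' := by
    intro A B hA hB v w
    simp only [Units.val_mul, mul_apply_eq_comp]
    rw [hA, hB]
  one_mem' := by
    intro v w
    simp
  inv_mem' := by
    intro A hA v w
    have e : ∀ u, (A : V →L[ℝ] V) ((A⁻¹ : (V →L[ℝ] V)ˣ).val u) = u := by
      intro u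
      rw [← mul_apply_eq_comp, Units.mul_inv, one_apply_eq_self]
    rw [← hA, e, e]

/-- The underlying endomorphism of an element of the symplectic group. -/
def spMap {V : Type*} [NormedAddCommGroup V] [NormedSpace ℝ V] {ω : LinearMap.BilinForm ℝ V}
    (A : Sp ω) : V →L[ℝ] V :=
  ((A : (V →L[ℝ] V)ˣ) : V →L[ℝ] V)

/-- The graph of a symplectic map is a Lagrangian subspace of `(V ⊕ V, ω ⊕ (-ω))`. -/
theorem isLagrangian_graph {V : Type*} [NormedAddCommGroup V] [NormedSpace ℝ V]
    [FiniteDimensional ℝ V] {ω : LinearMap.BilinForm ℝ V} (A : Sp ω) :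
    IsLagrangian (doubleForm ω) (LinearMap.graph (spMap A : V →ₗ[ℝ] V)) where
  isotropic := by
    rintro ⟨x, x'⟩ hx ⟨y, y'⟩ hy
    rw [LinearMap.mem_graph_iff] at hx hy
    simp only at hx hy
    subst hx hy
    have h := A.2 x y
    simp only [doubleForm, LinearMap.sub_apply, LinearMap.compl₁₂_apply, LinearMap.fst_apply,
      LinearMap.snd_apply, ContinuousLinearMap.coe_coe]
    exact sub_eq_zero.2 h.symm
  finrank_eq := by
    have e : Module.finrank ℝ (LinearMap.graph (spMap A : V →ₗ[ℝ] V)) = Module.finrank ℝ V := by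
      rw [LinearMap.graph_eq_range_prod]
      apply LinearMap.finrank_range_of_inj
      intro x y hxy
      exact (Prod.mk.inj hxy).1
    rw [e, Module.finrank_prod, two_mul]

/-- `Gr(A)` as a point of `Λ(V ⊕ V, ω ⊕ (-ω))`. -/
def Gr {V : Type*} [NormedAddCommGroup V] [NormedSpace ℝ V] [FiniteDimensional ℝ V]
    {ω : LinearMap.BilinForm ℝ V} (A : Sp ω) : LagrangianGrassmannian (doubleForm ω) :=
  ⟨LinearMap.graph (spMap A : V →ₗ[ℝ] V), isLagrangian_graph A⟩

/-- The Conley-Zehnder index of a continuous path in `Sp(V, ω)`: the Maslov index, relative to the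
diagonal `Δ = Gr(Id)`, of the path of graphs. -/
def conleyZehnder {V : Type*} [NormedAddCommGroup V] [NormedSpace ℝ V] [FiniteDimensional ℝ V]
    {ω : LinearMap.BilinForm ℝ V} (Φ : C(unitInterval, Sp ω)) : ℝ :=
  maslovIndex (doubleForm ω) (Gr 1) (fun t => Gr (Φ t))

/-- The symplectic Cayley transform `½ J (Id + A) (Id - A)⁻¹` of `A` (used only when `Id - A` is
invertible). -/
def symplecticCayley {V : Type*} [NormedAddCommGroup V] [NormedSpace ℝ V] (J A : V →L[ℝ] V) :
    V →L[ℝ] V :=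
  (1 / 2 : ℝ) • (J * (1 + A) * Ring.inverse (1 - A))

/-- The bilinear form `⟨A ·, ·⟩` of an operator `A`. -/
def operatorForm {V : Type*} [NormedAddCommGroup V] [InnerProductSpace ℝ V] (A : V →L[ℝ] V) :
    LinearMap.BilinForm ℝ V :=
  innerₗ V ∘ₗ (A : V →ₗ[ℝ] V)

end

/-!
The proof avoids the homotopy invariance of the Maslov index and compares the indices of `Φ₁`, `Φ₂`
and `Φ₁Φ₂` locally in time, by means of the Kashiwara index `τ(L₁, L₂, L₃)` of three Lagrangians,
the signature of the form `σ(x₂, x₁) + σ(x₃, x₂) + σ(x₁, x₃)` on `L₁ × L₂ × L₃`.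

Write `s(N; L₁, L₂)` (`chartSign`) for the signature of the chart `φ_{L₁,N}(L₂)`. An explicit
substitution diagonalizes the Kashiwara form when some Lagrangian `N` is transverse to the three
others, and gives the cocycle property (`kashiwaraIndex_eq_add`)
`τ(L₁, L₂, L₃) = s(N; L₁, L₂) + s(N; L₂, L₃) + s(N; L₃, L₁)`; moreover
`τ(L₁, L₂, N) = s(N; L₁, L₂)` when `L₂` and `N` are transverse (`kashiwaraIndex_eq_chartSign`). Any
finite set of Lagrangians has a common transverse one (`exists_isLagrangian_isCompl`), and
`s(N; L, L')` is locally constant for continuous families with `L`, `L'`, `N` pairwise transverse.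
Hence chart signatures relative to two different Lagrangians, even moving ones, differ by a locally
constant amount (`IsContinuousLagrangianFamily.eventually_chartSign_sub_eq`). So the Maslov index is
well defined: it is the increment of any function `F` with `F - ½ s(M; Δ, γ)` locally constant on
the domain of each chart (`IsMaslovPrimitive.maslovIndex_eq`).

If `F₁` and `F₂` are such functions for `Gr Φ₁` and `Gr Φ₂`, then
`F₁ + F₂ - ½ τ(Δ, Gr Φ₁, Gr (Φ₁Φ₂))` is one for `Gr (Φ₁Φ₂)` (`IsMaslovPrimitive.mul`), because the
cocycle property leaves the term `s(M; Gr Φ₁, Gr (Φ₁Φ₂))`, which the symplectic map `Id × Φ₁⁻¹`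
turns into `s(M'; Δ, Gr Φ₂)` for a moving Lagrangian `M'`. At time `0` the Kashiwara index vanishes;
at time `1` it is minus the signature of the sum of the Cayley transforms
(`kashiwaraIndex_Gr_eq_neg_formSign`). The result is symmetric in `Φ₁` and `Φ₂`.
-/

open Filter Topology

/-! ### Signatures of bilinear forms -/

section FormSign

variable {E F : Type*} [AddCommGroup E] [Module ℝ E] [AddCommGroup F] [Module ℝ F]

theorem formSign_eq_of_equiv {B : LinearMap.BilinForm ℝ E} {B' : LinearMap.BilinForm ℝ F}
    (e : E ≃ₗ[ℝ] F) (h : ∀ x, B' (e x) (e x) = B x x) : formSign B = formSign B' := by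
  have he : QuadraticMap.Equivalent B.toQuadraticMap B'.toQuadraticMap := ⟨{ e with map_app' := h }⟩
  rw [formSign, formSign, he.sigPos_eq, he.sigNeg_eq]

theorem formSign_neg (B : LinearMap.BilinForm ℝ E) : formSign (-B) = -formSign B := by
  have h : (-B).toQuadraticMap = -B.toQuadraticMap := rfl
  rw [formSign, formSign, h, sigPos_neg, sigNeg_neg, neg_sub]

/-- An automorphism that changes the sign of a form forces its signature to vanish. -/
theorem formSign_eq_zero_of_equiv {B : LinearMap.BilinForm ℝ E}
    (e : E ≃ₗ[ℝ] E) (h : ∀ x, B (e x) (e x) = -B x x) : formSign B = 0 := by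
  have := formSign_eq_of_equiv (B := -B) (B' := B) e h
  rw [formSign_neg] at this
  omega

theorem finrank_submodule_prod (p : Submodule ℝ E) (q : Submodule ℝ F) [FiniteDimensional ℝ p]
    [FiniteDimensional ℝ q] :
    Module.finrank ℝ (p.prod q) = Module.finrank ℝ p + Module.finrank ℝ q := by
  have h : p.prod q = LinearMap.range (p.subtype.prodMap q.subtype) := by
    rw [LinearMap.range_prodMap, Submodule.range_subtype, Submodule.range_subtype]
  rw [h, LinearMap.finrank_range_of_inj, Module.finrank_prod]
  exact p.injective_subtype.prodMap q.injective_subtype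

/-- The positive part of the signature is superadditive on orthogonal sums. -/
theorem sigPos_add_le_of_orthogonal [FiniteDimensional ℝ E] [FiniteDimensional ℝ F]
    {Q₁ : QuadraticForm ℝ E} {Q₂ : QuadraticForm ℝ F} {Q : QuadraticForm ℝ (E × F)}
    (h : ∀ x y, Q (x, y) = Q₁ x + Q₂ y) : sigPos Q₁ + sigPos Q₂ ≤ sigPos Q := by
  obtain ⟨V₁, hV₁, hp₁⟩ := exists_finrank_eq_sigPos_and_posDef Q₁
  obtain ⟨V₂, hV₂, hp₂⟩ := exists_finrank_eq_sigPos_and_posDef Q₂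
  have hV : Module.finrank ℝ (V₁.prod V₂) = sigPos Q₁ + sigPos Q₂ := by
    rw [finrank_submodule_prod, hV₁, hV₂]
  rw [← hV]
  apply le_sigPos_of_posDef
  rintro ⟨⟨x, y⟩, hx, hy⟩ hne
  simp only [QuadraticMap.restrict_apply, h]
  have h₁ : x ≠ 0 → 0 < Q₁ x := fun h0 => by
    simpa using hp₁ ⟨x, hx⟩ (by simpa using h0)
  have h₂ : y ≠ 0 → 0 < Q₂ y := fun h0 => by
    simpa using hp₂ ⟨y, hy⟩ (by simpa using h0)
  by_cases hx0 : x = 0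
  · by_cases hy0 : y = 0
    · exact absurd (by simp [hx0, hy0]) hne
    · simpa [hx0] using h₂ hy0
  · by_cases hy0 : y = 0
    · simpa [hy0] using h₁ hx0
    · exact add_pos (h₁ hx0) (h₂ hy0)

/-- The signature is additive on orthogonal sums. -/
theorem formSign_prod [FiniteDimensional ℝ E] [FiniteDimensional ℝ F]
    {B₁ : LinearMap.BilinForm ℝ E} {B₂ : LinearMap.BilinForm ℝ F}
    {B : LinearMap.BilinForm ℝ (E × F)}
    (h : ∀ x y, B (x, y) (x, y) = B₁ x x + B₂ y y) :
    formSign B = formSign B₁ + formSign B₂ := by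
  set Q := B.toQuadraticMap
  set Q₁ := B₁.toQuadraticMap
  set Q₂ := B₂.toQuadraticMap
  have hQ : ∀ x y, Q (x, y) = Q₁ x + Q₂ y := h
  have hp := sigPos_add_le_of_orthogonal hQ
  have hn : sigNeg Q₁ + sigNeg Q₂ ≤ sigNeg Q := by
    refine sigPos_add_le_of_orthogonal (Q₁ := -Q₁) (Q₂ := -Q₂) (Q := -Q) fun x y => ?_
    simp only [neg_apply, hQ]
    ring
  have hr : Module.finrank ℝ Q₁.radical + Module.finrank ℝ Q₂.radical
      ≤ Module.finrank ℝ Q.radical := by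
    rw [← finrank_submodule_prod]
    apply Submodule.finrank_mono
    rintro ⟨x, y⟩ ⟨hx, hy⟩
    rw [SetLike.mem_coe, QuadraticMap.mem_radical_iff'] at hx hy
    rw [QuadraticMap.mem_radical_iff']
    refine ⟨by rw [hQ]; linarith [hx.1, hy.1], ?_⟩
    rintro ⟨a, b⟩
    rw [Prod.mk_add_mk, hQ, hQ, hx.2, hy.2]
  have e₁ := QuadraticForm.sigPos_add_sigNeg_add_radical (Q := Q₁)
  have e₂ := QuadraticForm.sigPos_add_sigNeg_add_radical (Q := Q₂)
  have e := QuadraticForm.sigPos_add_sigNeg_add_radical (Q := Q)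
  rw [Module.finrank_prod] at e
  unfold formSign
  change (sigNeg Q : ℤ) - sigPos Q = (sigNeg Q₁ - sigPos Q₁) + (sigNeg Q₂ - sigPos Q₂)
  omega

end FormSign

section LocallyConstant

variable {X F : Type*} [TopologicalSpace X] [NormedAddCommGroup F] [NormedSpace ℝ F]
  [FiniteDimensional ℝ F]

/-- The positive part of the signature is lower semicontinuous. -/
theorem eventually_sigPos_le {Q : X → QuadraticForm ℝ F} {t₀ : X}
    (hQ : ∀ z, ContinuousAt (fun p : X × F => Q p.1 p.2) (t₀, z)) :
    ∀ᶠ t in 𝓝 t₀, sigPos (Q t₀) ≤ sigPos (Q t) := by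
  obtain ⟨W, hW, hpos⟩ := exists_finrank_eq_sigPos_and_posDef (Q t₀)
  have hK : IsCompact (Metric.sphere (0 : F) 1 ∩ W) :=
    (isCompact_sphere 0 1).inter_right W.closed_of_finiteDimensional
  have key : ∀ᶠ t in 𝓝 t₀, ∀ z ∈ Metric.sphere (0 : F) 1 ∩ W, 0 < Q t z := by
    refine hK.eventually_forall_of_forall_eventually fun z hz => ?_
    refine (hQ z).eventually (lt_mem_nhds ?_)
    have hz0 : z ≠ 0 := by
      rintro rfl
      simp at hz
    simpa using hpos ⟨z, hz.2⟩ (by simpa using hz0)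
  filter_upwards [key] with t ht
  rw [← hW]
  apply le_sigPos_of_posDef
  rintro ⟨z, hz⟩ hne
  have hz0 : z ≠ 0 := by simpa using hne
  have hn : 0 < ‖z‖ := norm_pos_iff.2 hz0
  have := ht (‖z‖⁻¹ • z) ⟨by simp [norm_smul, hn.ne'], W.smul_mem _ hz⟩
  rw [QuadraticMap.map_smul, smul_eq_mul] at this
  simpa using pos_of_mul_pos_right this (by positivity)

/-- The signature of a continuous family of forms is locally constant where the form is symmetric
and nondegenerate. -/
theorem eventually_formSign_eq {B : X → LinearMap.BilinForm ℝ F} {t₀ : X}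
    (hB : ∀ z, ContinuousAt (fun p : X × F => B p.1 p.2 p.2) (t₀, z))
    (hsymm : ∀ x y, B t₀ x y = B t₀ y x) (hnd : ∀ x, (∀ y, B t₀ x y = 0) → x = 0) :
    ∀ᶠ t in 𝓝 t₀, formSign (B t) = formSign (B t₀) := by
  have hrad : (B t₀).toQuadraticMap.radical = ⊥ := by
    rw [eq_bot_iff]
    intro x hx
    refine hnd x fun y => ?_
    rw [QuadraticMap.mem_radical_iff'] at hx
    have h₁ : B t₀ x x = 0 := hx.1
    have h₂ : B t₀ (x + y) (x + y) = B t₀ y y := hx.2 y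
    simp only [map_add, LinearMap.add_apply, hsymm y x] at h₂
    linarith
  have e₀ := QuadraticForm.sigPos_add_sigNeg_add_radical (Q := (B t₀).toQuadraticMap)
  rw [hrad, finrank_bot] at e₀
  have hp := eventually_sigPos_le (Q := fun t => (B t).toQuadraticMap) hB
  have hn := eventually_sigPos_le (Q := fun t => -(B t).toQuadraticMap) fun z => (hB z).neg
  filter_upwards [hp, hn] with t hp hn
  have e := QuadraticForm.sigPos_add_sigNeg_add_radical (Q := (B t).toQuadraticMap)
  simp only [sigPos_neg] at hn
  unfold formSign
  omega

end LocallyConstant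

/-! ### Chart signatures and the Kashiwara index -/

noncomputable section

open Classical in
/-- The signature of the chart `φ_{L₁,N}(L₂)`, as a function of all triples of subspaces, with the
value `0` if `L₂` is not transverse to `N`. -/
def chartSign {E : Type*} [AddCommGroup E] [Module ℝ E] (σ : LinearMap.BilinForm ℝ E)
    (N L₁ L₂ : Submodule ℝ E) : ℤ :=
  if h : IsCompl L₂ N then formSign (lagrangianChart σ L₁ N L₂ h) else 0

/-- The form `σ(x₂, x₁) + σ(x₃, x₂) + σ(x₁, x₃)` on `L₁ × L₂ × L₃`, up to sign the one whose
signature is Kashiwara's index of the triple `(L₁, L₂, L₃)`. It is not symmetric; only its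
quadratic form matters. -/
def kashiwaraForm {E : Type*} [AddCommGroup E] [Module ℝ E] (σ : LinearMap.BilinForm ℝ E)
    (L₁ L₂ L₃ : Submodule ℝ E) : LinearMap.BilinForm ℝ (L₁ × L₂ × L₃) :=
  let p₁ := L₁.subtype ∘ₗ LinearMap.fst ℝ L₁ (L₂ × L₃)
  let p₂ := L₂.subtype ∘ₗ LinearMap.fst ℝ L₂ L₃ ∘ₗ LinearMap.snd ℝ L₁ (L₂ × L₃)
  let p₃ := L₃.subtype ∘ₗ LinearMap.snd ℝ L₂ L₃ ∘ₗ LinearMap.snd ℝ L₁ (L₂ × L₃)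
  σ.compl₁₂ p₂ p₁ + σ.compl₁₂ p₃ p₂ + σ.compl₁₂ p₁ p₃

/-- The Kashiwara index of a triple of subspaces. -/
def kashiwaraIndex {E : Type*} [AddCommGroup E] [Module ℝ E] (σ : LinearMap.BilinForm ℝ E)
    (L₁ L₂ L₃ : Submodule ℝ E) : ℤ :=
  formSign (kashiwaraForm σ L₁ L₂ L₃)

end

section Kashiwara

variable {E F : Type*} [AddCommGroup E] [Module ℝ E] [AddCommGroup F] [Module ℝ F]
  {σ : LinearMap.BilinForm ℝ E} {N L₁ L₂ L₃ : Submodule ℝ E}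

theorem chartSign_of_isCompl (h : IsCompl L₂ N) :
    chartSign σ N L₁ L₂ = formSign (lagrangianChart σ L₁ N L₂ h) :=
  dif_pos h

theorem graphMap_eq_sub (h : IsCompl L₂ N) {x : L₁} {y : E} (hy : y ∈ L₂) (hxy : y - x ∈ N) :
    (graphMap L₁ N L₂ h x : E) = y - x := by
  have hx : (x : E) = y - (y - x) := by abel
  have h₁ : N.projectionOnto L₂ h.symm y = 0 :=
    (Submodule.projectionOnto_apply_eq_zero_iff h.symm).2 hy
  have h₂ := Submodule.projectionOnto_apply_left h.symm ⟨y - x, hxy⟩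
  simp only at h₂
  simp only [graphMap, LinearMap.neg_apply, LinearMap.comp_apply, Submodule.subtype_apply]
  rw [hx, map_sub, h₁, h₂]
  simp

/-- The chart signature in a parametrization `a₁` of `L₁`, when `a₂ z` is the point of `L₂`
congruent to `a₁ z` modulo `N`. -/
theorem chartSign_eq_formSign (hσ : σ.IsAlt) (h : IsCompl L₂ N) (a₁ : F ≃ₗ[ℝ] L₁) (a₂ : F → E)
    (h₂ : ∀ z, a₂ z ∈ L₂) (hN : ∀ z, a₂ z - a₁ z ∈ N) (B : LinearMap.BilinForm ℝ F)
    (hB : ∀ z, B z z = σ (a₂ z) (a₁ z)) : chartSign σ N L₁ L₂ = formSign B := by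
  rw [chartSign_of_isCompl h]
  refine (formSign_eq_of_equiv a₁ fun z => ?_).symm
  simp only [lagrangianChart, LinearMap.compl₁₂_apply, LinearMap.comp_apply,
    Submodule.subtype_apply]
  rw [graphMap_eq_sub h (h₂ z) (hN z), map_sub, LinearMap.sub_apply, hσ.self_eq_zero, sub_zero, hB]

theorem kashiwaraForm_apply_self (x₁ : L₁) (x₂ : L₂) (x₃ : L₃) :
    kashiwaraForm σ L₁ L₂ L₃ (x₁, x₂, x₃) (x₁, x₂, x₃)
      = σ x₂ x₁ + σ x₃ x₂ + σ x₁ x₃ := rfl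

theorem kashiwaraIndex_rotate : kashiwaraIndex σ L₁ L₂ L₃ = kashiwaraIndex σ L₂ L₃ L₁ := by
  refine formSign_eq_of_equiv (LinearEquiv.prodComm ℝ _ _ ≪≫ₗ LinearEquiv.prodAssoc ℝ _ _ _) ?_
  rintro ⟨x₁, x₂, x₃⟩
  change kashiwaraForm σ L₂ L₃ L₁ (x₂, x₃, x₁) (x₂, x₃, x₁) = _
  simp only [kashiwaraForm_apply_self]
  ring

theorem kashiwaraIndex_self (hσ : σ.IsAlt) (L : Submodule ℝ E) : kashiwaraIndex σ L L L = 0 := by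
  refine formSign_eq_zero_of_equiv
    ((LinearEquiv.prodAssoc ℝ L L L).symm ≪≫ₗ
      (LinearEquiv.prodComm ℝ L L).prodCongr (LinearEquiv.refl ℝ L) ≪≫ₗ
      LinearEquiv.prodAssoc ℝ L L L) ?_
  rintro ⟨x₁, x₂, x₃⟩
  change kashiwaraForm σ L L L (x₂, x₁, x₃) (x₂, x₁, x₃) = _
  simp only [kashiwaraForm_apply_self]
  rw [← hσ.neg_eq (x₁ : E) x₂, ← hσ.neg_eq (x₃ : E) x₁, ← hσ.neg_eq (x₂ : E) x₃]
  ring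

theorem chartSign_swap (hσ : σ.IsAlt) (h₁ : IsCompl L₁ N) (h₂ : IsCompl L₂ N) :
    chartSign σ N L₂ L₁ = -chartSign σ N L₁ L₂ := by
  set a₁ := N.quotientEquivOfIsCompl L₁ h₁.symm
  set a₂ := N.quotientEquivOfIsCompl L₂ h₂.symm
  have hN : ∀ z, (a₂ z : E) - a₁ z ∈ N := fun z => by
    rw [← Submodule.Quotient.eq]
    simp [a₁, a₂]
  set B : LinearMap.BilinForm ℝ (E ⧸ N) :=
    σ.compl₁₂ (L₂.subtype ∘ₗ a₂.toLinearMap) (L₁.subtype ∘ₗ a₁.toLinearMap)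
  rw [chartSign_eq_formSign hσ h₂ a₁ (fun z => a₂ z) (fun z => (a₂ z).2) hN B fun z => rfl,
    chartSign_eq_formSign hσ h₁ a₂ (fun z => a₁ z) (fun z => (a₁ z).2)
      (fun z => by rw [← neg_sub]; exact N.neg_mem (hN z)) (-B) fun z => ?_, formSign_neg]
  simpa [B] using hσ.neg_eq (a₂ z : E) (a₁ z)

/-- The cocycle property: if `N` is transverse to the three Lagrangians, then the Kashiwara index
is the cyclic sum of chart signatures. In the parametrizations `aᵢ` of the `Lᵢ` by `E ⧸ N`, the
substitution `x₁ = a₁(y + z)`, `x₂ = a₂(z + x)`, `x₃ = a₃(x + y)` splits the Kashiwara form into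
the orthogonal sum of the three chart forms. -/
theorem kashiwaraIndex_eq_add [FiniteDimensional ℝ E] (hσ : σ.IsAlt)
    (hN : ∀ x ∈ N, ∀ y ∈ N, σ x y = 0) (hL₁ : ∀ x ∈ L₁, ∀ y ∈ L₁, σ x y = 0) (hL₂ : ∀ x ∈ L₂, ∀ y ∈ L₂, σ x y = 0)
    (hL₃ : ∀ x ∈ L₃, ∀ y ∈ L₃, σ x y = 0)
    (h₁ : IsCompl L₁ N) (h₂ : IsCompl L₂ N) (h₃ : IsCompl L₃ N) :
    kashiwaraIndex σ L₁ L₂ L₃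
      = chartSign σ N L₁ L₂ + chartSign σ N L₂ L₃ + chartSign σ N L₃ L₁ := by
  set a₁ := N.quotientEquivOfIsCompl L₁ h₁.symm
  set a₂ := N.quotientEquivOfIsCompl L₂ h₂.symm
  set a₃ := N.quotientEquivOfIsCompl L₃ h₃.symm
  have h₂₁ : ∀ z, (a₂ z : E) - a₁ z ∈ N := fun z => by
    rw [← Submodule.Quotient.eq]; simp [a₁, a₂]
  have h₃₂ : ∀ z, (a₃ z : E) - a₂ z ∈ N := fun z => by
    rw [← Submodule.Quotient.eq]; simp [a₂, a₃]
  have h₁₃ : ∀ z, (a₁ z : E) - a₃ z ∈ N := fun z => by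
    rw [← Submodule.Quotient.eq]; simp [a₁, a₃]
  let B₁ : LinearMap.BilinForm ℝ (E ⧸ N) :=
    σ.compl₁₂ (L₂.subtype ∘ₗ a₂.toLinearMap) (L₁.subtype ∘ₗ a₁.toLinearMap)
  let B₂ : LinearMap.BilinForm ℝ (E ⧸ N) :=
    σ.compl₁₂ (L₃.subtype ∘ₗ a₃.toLinearMap) (L₂.subtype ∘ₗ a₂.toLinearMap)
  let B₃ : LinearMap.BilinForm ℝ (E ⧸ N) :=
    σ.compl₁₂ (L₁.subtype ∘ₗ a₁.toLinearMap) (L₃.subtype ∘ₗ a₃.toLinearMap)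
  rw [chartSign_eq_formSign hσ h₂ a₁ (fun z => a₂ z) (fun z => (a₂ z).2) h₂₁ B₁ fun z => rfl,
    chartSign_eq_formSign hσ h₃ a₂ (fun z => a₃ z) (fun z => (a₃ z).2) h₃₂ B₂ fun z => rfl,
    chartSign_eq_formSign hσ h₁ a₃ (fun z => a₁ z) (fun z => (a₁ z).2) h₁₃ B₃ fun z => rfl]
  let G := E ⧸ N
  let m : (G × G × G) ≃ₗ[ℝ] (G × G × G) :=
    { toFun := fun p => (p.2.2 + p.1, p.1 + p.2.1, p.2.1 + p.2.2)
      invFun := fun q => ((1 / 2 : ℝ) • (q.1 + q.2.1 - q.2.2), (1 / 2 : ℝ) • (q.2.1 + q.2.2 - q.1),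
        (1 / 2 : ℝ) • (q.1 + q.2.2 - q.2.1))
      map_add' := fun p q => by
        ext <;> simp only [Prod.fst_add, Prod.snd_add] <;> abel
      map_smul' := fun c p => by
        ext <;> simp
      left_inv := fun p => by
        ext <;> simp only <;> module
      right_inv := fun q => by
        ext <;> simp only <;> module }
  let pullback : LinearMap.BilinForm ℝ (G × G × G) :=
    (kashiwaraForm σ L₁ L₂ L₃).compl₁₂ (a₁.prodCongr (a₂.prodCongr a₃) ∘ₗ m.toLinearMap)
      (a₁.prodCongr (a₂.prodCongr a₃) ∘ₗ m.toLinearMap)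
  let B₂₃ : LinearMap.BilinForm ℝ (G × G) :=
    B₂.compl₁₂ (LinearMap.fst ℝ G G) (LinearMap.fst ℝ G G)
      + B₃.compl₁₂ (LinearMap.snd ℝ G G) (LinearMap.snd ℝ G G)
  have e₁ : formSign pullback = kashiwaraIndex σ L₁ L₂ L₃ :=
    formSign_eq_of_equiv (m ≪≫ₗ a₁.prodCongr (a₂.prodCongr a₃)) fun x => rfl
  have e₂ : formSign B₂₃ = formSign B₂ + formSign B₃ := formSign_prod fun x y => rfl
  rw [← e₁, add_assoc, ← e₂]
  refine formSign_prod ?_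
  rintro z ⟨x, y⟩
  change kashiwaraForm σ L₁ L₂ L₃ (a₁ (y + z), a₂ (z + x), a₃ (x + y))
    (a₁ (y + z), a₂ (z + x), a₃ (x + y)) = σ (a₂ z) (a₁ z) + (σ (a₃ x) (a₂ x) + σ (a₁ y) (a₃ y))
  rw [kashiwaraForm_apply_self]
  simp only [map_add, Submodule.coe_add, LinearMap.add_apply]
  -- Each cross term vanishes because the `Lᵢ` and `N` are isotropic.
  have c₁ := hN _ (h₃₂ x) _ (h₂₁ z)
  have c₂ := hN _ (h₁₃ y) _ (h₃₂ x)
  have c₃ := hN _ (h₂₁ z) _ (h₁₃ y)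
  have i₁ := hL₁ _ (a₁ y).2 _ (a₁ z).2
  have i₂ := hL₂ _ (a₂ z).2 _ (a₂ x).2
  have i₃ := hL₃ _ (a₃ x).2 _ (a₃ y).2
  have s := fun u v : E => hσ.neg_eq u v
  simp only [map_sub, LinearMap.sub_apply] at c₁ c₂ c₃
  have s₁ := s (a₁ y) (a₁ z)
  have s₂ := s (a₂ z) (a₂ x)
  have s₃ := s (a₃ x) (a₃ y)
  have s₄ := s (a₁ z) (a₃ x)
  have s₅ := s (a₂ x) (a₁ y)
  have s₆ := s (a₃ y) (a₂ z)
  have s₇ := s (a₁ y) (a₂ z)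
  have s₈ := s (a₁ z) (a₂ x)
  have s₉ := s (a₂ z) (a₃ x)
  have s₁₀ := s (a₂ x) (a₃ y)
  have s₁₁ := s (a₃ x) (a₁ y)
  have s₁₂ := s (a₃ y) (a₁ z)
  linarith

/-- If the third Lagrangian is transverse to the second, then the Kashiwara index is the chart
signature relative to it: the Kashiwara form is the orthogonal sum of the chart form and of a
pairing between `L₂` and `N`. -/
theorem kashiwaraIndex_eq_chartSign [FiniteDimensional ℝ E] (hσ : σ.IsAlt)
    (hN : ∀ x ∈ N, ∀ y ∈ N, σ x y = 0) (hL₂ : ∀ x ∈ L₂, ∀ y ∈ L₂, σ x y = 0) (h₂ : IsCompl L₂ N) :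
    kashiwaraIndex σ L₁ L₂ N = chartSign σ N L₁ L₂ := by
  -- `x + T x ∈ L₂` for `x ∈ L₁`
  let T := graphMap L₁ N L₂ h₂
  let P : L₁ →ₗ[ℝ] L₂ := L₂.projectionOnto N h₂ ∘ₗ L₁.subtype
  have hP : ∀ x, (P x : E) = x + T x := fun x => by
    have := Submodule.projection_add_projection_eq_self h₂ (x : E)
    simp only [Submodule.projection_apply] at this
    simp only [P, T, graphMap, LinearMap.neg_apply, LinearMap.comp_apply, Submodule.subtype_apply,
      Submodule.coe_neg]
    rw [eq_comm, ← sub_eq_add_neg, sub_eq_iff_eq_add, this]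
  let m : (L₁ × L₂ × N) ≃ₗ[ℝ] (L₁ × L₂ × N) :=
    LinearEquiv.skewProd (LinearEquiv.refl ℝ L₁) (LinearEquiv.refl ℝ (L₂ × N)) (P.prod (-T))
  let C : LinearMap.BilinForm ℝ (L₂ × N) :=
    σ.compl₁₂ (N.subtype ∘ₗ LinearMap.snd ℝ L₂ N) (L₂.subtype ∘ₗ LinearMap.fst ℝ L₂ N)
  have hC : formSign C = 0 := by
    refine formSign_eq_zero_of_equiv
      ((LinearEquiv.refl ℝ L₂).prodCongr (LinearEquiv.neg ℝ)) ?_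
    rintro ⟨w, n⟩
    change σ ((-n : N) : E) w = -σ n w
    simp
  let pullback : LinearMap.BilinForm ℝ (L₁ × L₂ × N) :=
    (kashiwaraForm σ L₁ L₂ N).compl₁₂ m.toLinearMap m.toLinearMap
  have e : formSign pullback = kashiwaraIndex σ L₁ L₂ N := formSign_eq_of_equiv m fun x => rfl
  rw [chartSign_of_isCompl h₂, ← e, ← add_zero (formSign (lagrangianChart _ _ _ _ _)), ← hC]
  refine formSign_prod ?_
  rintro x ⟨w, n⟩
  change kashiwaraForm σ L₁ L₂ N (x, w + P x, n + -T x) (x, w + P x, n + -T x)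
    = σ (T x) x + σ n w
  rw [kashiwaraForm_apply_self]
  have c₁ := hN _ n.2 _ (T x).2
  have c₂ := hL₂ _ w.2 _ (P x).2
  have c₃ := hσ.self_eq_zero (x : E)
  have c₄ := hσ.self_eq_zero (T x : E)
  have c₅ := hσ.neg_eq (w : E) x
  have c₆ := hσ.neg_eq (w : E) (T x)
  have c₇ := hσ.neg_eq (n : E) x
  have c₈ := hσ.neg_eq (T x : E) x
  simp only [hP, map_add, map_neg, LinearMap.add_apply, LinearMap.neg_apply, Submodule.coe_add,
    Submodule.coe_neg] at *
  linarith

end Kashiwara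

/-! ### Common transverse Lagrangians -/

section CommonTransverse

variable {E : Type*} [AddCommGroup E] [Module ℝ E] [FiniteDimensional ℝ E]
  {σ : LinearMap.BilinForm ℝ E}

theorem finrank_isotropic_le (hσ : σ.Nondegenerate) {W : Submodule ℝ E}
    (hW : ∀ x ∈ W, ∀ y ∈ W, σ x y = 0) : 2 * Module.finrank ℝ W ≤ Module.finrank ℝ E := by
  have h₁ : W ≤ σ.orthogonal W := fun x hx => by
    rw [LinearMap.BilinForm.mem_orthogonal_iff]
    exact fun y hy => hW y hy x hx
  have h₂ := Submodule.finrank_mono h₁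
  have h₃ := LinearMap.BilinForm.finrank_orthogonal hσ W
  omega

/-- A Lagrangian subspace is its own orthogonal. -/
theorem IsLagrangian.mem_of_forall (hσ : σ.Nondegenerate) {L : Submodule ℝ E}
    (hL : IsLagrangian σ L) {x : E} (hx : ∀ y ∈ L, σ y x = 0) : x ∈ L := by
  have h₁ : L ≤ σ.orthogonal L := fun x hx => by
    rw [LinearMap.BilinForm.mem_orthogonal_iff]
    exact fun y hy => hL.isotropic y hy x hx
  have h₃ := LinearMap.BilinForm.finrank_orthogonal hσ L
  have := hL.finrank_eq
  rw [Submodule.eq_of_le_of_finrank_eq h₁ (by omega), LinearMap.BilinForm.mem_orthogonal_iff]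
  exact hx

/-- An isotropic subspace that meets finitely many Lagrangians trivially and is not itself
Lagrangian can be enlarged: the Lagrangians `Lᵢ` only forbid a vector `v` of the orthogonal `W'` of
`W` to lie in the proper subspaces `(Lᵢ ∩ W') + W`. -/
theorem exists_isotropic_finrank_succ {ι : Type*} [Finite ι] [Nonempty ι] (hσ : σ.Nondegenerate)
    (halt : σ.IsAlt) {L : ι → Submodule ℝ E} (hL : ∀ i, IsLagrangian σ (L i)) {W : Submodule ℝ E}
    (hW : ∀ x ∈ W, ∀ y ∈ W, σ x y = 0) (hd : ∀ i, Disjoint (L i) W)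
    (hlt : 2 * Module.finrank ℝ W < Module.finrank ℝ E) :
    ∃ W' : Submodule ℝ E, (∀ x ∈ W', ∀ y ∈ W', σ x y = 0) ∧ (∀ i, Disjoint (L i) W') ∧
      Module.finrank ℝ W' = Module.finrank ℝ W + 1 := by
  set O := σ.orthogonal W
  have memO : ∀ {x}, x ∈ O ↔ ∀ y ∈ W, σ y x = 0 := LinearMap.BilinForm.mem_orthogonal_iff
  have hO' : Module.finrank ℝ O = Module.finrank ℝ E - Module.finrank ℝ W :=
    LinearMap.BilinForm.finrank_orthogonal hσ W
  have hWO : W ≤ O := fun x hx => memO.2 fun y hy => hW y hy x hx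
  let P : ι → Submodule ℝ E := fun i => (L i ⊓ O) ⊔ W
  have hP : ∀ i, ∀ x ∈ P i, ∀ y ∈ P i, σ x y = 0 := by
    intro i x hx y hy
    obtain ⟨a, ha, b, hb, rfl⟩ := Submodule.mem_sup.1 hx
    obtain ⟨c, hc, d, hd, rfl⟩ := Submodule.mem_sup.1 hy
    have e₁ := (hL i).isotropic a ha.1 c hc.1
    have e₂ := memO.1 ha.2 d hd
    have e₃ := memO.1 hc.2 b hb
    have e₄ := hW b hb d hd
    have e₅ := halt.neg_eq d a
    simp only [map_add, LinearMap.add_apply]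
    linarith
  obtain ⟨v, hvO, hvP⟩ : ∃ v ∈ O, ∀ i, v ∉ P i := by
    by_contra! hcon
    obtain ⟨i, hi⟩ := Subspace.exists_eq_top_of_iUnion_eq_univ
      (p := fun i => (P i).comap O.subtype) (Set.eq_univ_of_forall fun v => by
        obtain ⟨i, hi⟩ := hcon v v.2
        exact Set.mem_iUnion.2 ⟨i, hi⟩)
    have hle : O ≤ P i := by simpa [Submodule.comap_subtype_eq_top] using hi
    have h₁ := Submodule.finrank_mono hle
    have h₂ := finrank_isotropic_le hσ (hP i)
    omega
  have hvW : v ∉ W := fun h =>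
    hvP (Classical.arbitrary ι) (Submodule.mem_sup_right h)
  refine ⟨W ⊔ Submodule.span ℝ {v}, ?_, ?_, Submodule.finrank_sup_span_singleton hvW⟩
  · intro x hx y hy
    obtain ⟨a, ha, b, hb, rfl⟩ := Submodule.mem_sup.1 hx
    obtain ⟨c, hc, d, hd, rfl⟩ := Submodule.mem_sup.1 hy
    obtain ⟨r, rfl⟩ := Submodule.mem_span_singleton.1 hb
    obtain ⟨s, rfl⟩ := Submodule.mem_span_singleton.1 hd
    have e₁ := hW a ha c hc
    have e₂ := memO.1 hvO a ha
    have e₃ := memO.1 hvO c hc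
    have e₄ := halt.neg_eq c v
    have e₅ := halt.self_eq_zero v
    have e₆ : σ v c = 0 := by linarith
    simp [e₁, e₂, e₅, e₆]
  · intro i
    rw [Submodule.disjoint_def]
    intro x hx hxW
    obtain ⟨a, ha, b, hb, rfl⟩ := Submodule.mem_sup.1 hxW
    obtain ⟨r, rfl⟩ := Submodule.mem_span_singleton.1 hb
    have hxO : a + r • v ∈ O := O.add_mem (hWO ha) (O.smul_mem r hvO)
    by_cases hr : r = 0
    · subst hr
      rw [zero_smul, add_zero] at hx ⊢
      exact Submodule.disjoint_def.1 (hd i) a hx ha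
    · refine absurd ?_ (hvP i)
      have : v = r⁻¹ • ((a + r • v) - a) := by
        rw [add_sub_cancel_left, inv_smul_smul₀ hr]
      rw [this]
      exact (P i).smul_mem _ ((P i).sub_mem (Submodule.mem_sup_left ⟨hx, hxO⟩)
        (Submodule.mem_sup_right ha))

/-- Finitely many Lagrangian subspaces have a common transverse Lagrangian. -/
theorem exists_isLagrangian_isCompl {ι : Type*} [Finite ι] [Nonempty ι] (hσ : σ.Nondegenerate)
    (halt : σ.IsAlt) {L : ι → Submodule ℝ E} (hL : ∀ i, IsLagrangian σ (L i)) :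
    ∃ N, IsLagrangian σ N ∧ ∀ i, IsCompl (L i) N := by
  set d := Module.finrank ℝ (L (Classical.arbitrary ι))
  have hd : 2 * d = Module.finrank ℝ E := (hL _).finrank_eq
  have key : ∀ k ≤ d, ∃ W : Submodule ℝ E, (∀ x ∈ W, ∀ y ∈ W, σ x y = 0) ∧
      (∀ i, Disjoint (L i) W) ∧ Module.finrank ℝ W = k := by
    intro k
    induction k with
    | zero => exact fun _ => ⟨⊥, by simp, fun i => disjoint_bot_right, finrank_bot ℝ E⟩
    | succ k ih =>
      intro hk
      obtain ⟨W, hW, hWd, rfl⟩ := ih (by omega)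
      exact exists_isotropic_finrank_succ hσ halt hL hW hWd (by omega)
  obtain ⟨N, hN, hNd, hNk⟩ := key d le_rfl
  refine ⟨N, ⟨hN, by omega⟩, fun i => (Submodule.isCompl_iff_disjoint _ _ ?_).2 (hNd i)⟩
  have := (hL i).finrank_eq
  omega

end CommonTransverse

/-! ### Continuous families of Lagrangians -/

/-- A continuous family of Lagrangian subspaces, given as the images of one fixed subspace under a
norm-continuous family of injective endomorphisms. This avoids a topology on the Lagrangian
Grassmannian. -/
structure IsContinuousLagrangianFamily {X E : Type*} [TopologicalSpace X] [NormedAddCommGroup E]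
    [NormedSpace ℝ E] (σ : LinearMap.BilinForm ℝ E) (L : X → Submodule ℝ E) : Prop where
  exists_map : ∃ (K : Submodule ℝ E) (g : X → E →L[ℝ] E), Continuous g ∧
    (∀ t, Function.Injective (g t)) ∧ ∀ t, L t = K.map (g t : E →ₗ[ℝ] E)
  isLagrangian : ∀ t, IsLagrangian σ (L t)

section Families

variable {X E : Type*} [TopologicalSpace X] [NormedAddCommGroup E] [NormedSpace ℝ E]
  {σ : LinearMap.BilinForm ℝ E}

theorem IsLagrangian.isContinuousLagrangianFamily_const {N : Submodule ℝ E}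
    (hN : IsLagrangian σ N) : IsContinuousLagrangianFamily σ fun _ : X => N where
  exists_map := ⟨N, fun _ => ContinuousLinearMap.id ℝ E, continuous_const,
    fun _ => Function.injective_id, fun _ => (Submodule.map_id N).symm⟩
  isLagrangian _ := hN

/-- The sum map `K × K' → E` of two injective maps is bijective if and only if the images of `K` and
`K'` are complementary. -/
theorem bijective_coprod_iff {K K' : Submodule ℝ E} {g g' : E →L[ℝ] E}
    (hg : Function.Injective g) (hg' : Function.Injective g') :
    Function.Bijective ((g ∘L K.subtypeL).coprod (g' ∘L K'.subtypeL)) ↔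
      IsCompl (K.map (g : E →ₗ[ℝ] E)) (K'.map (g' : E →ₗ[ℝ] E)) := by
  constructor
  · rintro ⟨hi, hs⟩
    refine ⟨Submodule.disjoint_def.2 ?_, codisjoint_iff.2 (eq_top_iff.2 fun x _ => ?_)⟩
    · rintro _ ⟨k, hk, rfl⟩ ⟨k', hk', he⟩
      have := @hi (⟨k, hk⟩, -⟨k', hk'⟩) 0 (by
        simp only [ContinuousLinearMap.coe_coe] at he
        simp [he])
      have hk0 : k = 0 := congrArg (fun p => (p.1 : E)) this
      simp [hk0]
    · obtain ⟨⟨k, k'⟩, rfl⟩ := hs x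
      exact Submodule.add_mem_sup ⟨k, k.2, rfl⟩ ⟨k', k'.2, rfl⟩
  · intro h
    constructor
    · rw [injective_iff_map_eq_zero]
      rintro ⟨k, k'⟩ hkk
      have h0 : g k + g' k' = 0 := hkk
      have h1 : g k = 0 := Submodule.disjoint_def.1 h.disjoint _ ⟨k, k.2, rfl⟩
        ⟨-k', K'.neg_mem k'.2, by
          simp only [ContinuousLinearMap.coe_coe, map_neg]
          rw [eq_neg_of_add_eq_zero_left h0]⟩
      have h2 : g' k' = 0 := by rwa [h1, zero_add] at h0
      have e1 := hg (h1.trans (map_zero g).symm)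
      have e2 := hg' (h2.trans (map_zero g').symm)
      ext <;> assumption
    · intro x
      obtain ⟨_, ⟨k, hk, rfl⟩, _, ⟨k', hk', rfl⟩, rfl⟩ := Submodule.mem_sup.1
        (h.sup_eq_top ▸ Submodule.mem_top : x ∈ K.map (g : E →ₗ[ℝ] E) ⊔ K'.map (g' : E →ₗ[ℝ] E))
      exact ⟨(⟨k, hk⟩, ⟨k', hk'⟩), rfl⟩

variable [FiniteDimensional ℝ E] {L L' : X → Submodule ℝ E} {t₀ : X}

theorem continuous_bilinForm (σ : LinearMap.BilinForm ℝ E) :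
    Continuous fun p : E × E => σ p.1 p.2 := by
  let S : E →ₗ[ℝ] (E →L[ℝ] ℝ) := LinearMap.toContinuousLinearMap.toLinearMap ∘ₗ σ
  have hS : Continuous S := S.continuous_of_finiteDimensional
  exact (hS.comp continuous_fst).clm_apply continuous_snd

/-- Transversality is an open condition. -/
theorem IsContinuousLagrangianFamily.eventually_isCompl (hL : IsContinuousLagrangianFamily σ L)
    (hL' : IsContinuousLagrangianFamily σ L') (h : IsCompl (L t₀) (L' t₀)) :
    ∀ᶠ t in 𝓝 t₀, IsCompl (L t) (L' t) := by
  obtain ⟨K, g, hg, hi, hLg⟩ := hL.exists_map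
  obtain ⟨K', g', hg', hi', hLg'⟩ := hL'.exists_map
  simp only [hLg, hLg', ← bijective_coprod_iff (hi _) (hi' _)] at h ⊢
  set S : X → (K × K') →L[ℝ] E := fun t => (g t ∘L K.subtypeL).coprod (g' t ∘L K'.subtypeL)
  have hcont : Continuous S := by
    have h₁ : Continuous fun t => g t ∘L K.subtypeL := hg.clm_comp continuous_const
    have h₂ : Continuous fun t => g' t ∘L K'.subtypeL := hg'.clm_comp continuous_const
    exact (ContinuousLinearMap.coprodEquivL ℝ).continuous.comp (h₁.prodMk h₂)
  let e : (K × K') ≃L[ℝ] E := (LinearEquiv.ofBijective _ h).toContinuousLinearEquiv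
  have he : (e : (K × K') →L[ℝ] E) = S t₀ := rfl
  have := hcont.continuousAt.eventually (he ▸ e.nhds)
  filter_upwards [this] with t ⟨f, hf⟩
  have : (S t : K × K' → E) = f := by rw [← hf]; rfl
  rw [this]
  exact f.bijective

/-- The chart signature `φ_{L,N}(L')` is locally constant where `L` and `L'` are transverse. -/
theorem IsContinuousLagrangianFamily.eventually_chartSign_eq (halt : σ.IsAlt)
    (hnd : σ.Nondegenerate) (hL : IsContinuousLagrangianFamily σ L)
    (hL' : IsContinuousLagrangianFamily σ L') {N : Submodule ℝ E} (hN : IsLagrangian σ N)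
    (h : IsCompl (L t₀) (L' t₀)) (h₁ : IsCompl (L t₀) N) (h₂ : IsCompl (L' t₀) N) :
    ∀ᶠ t in 𝓝 t₀, chartSign σ N (L t) (L' t) = chartSign σ N (L t₀) (L' t₀) := by
  have hev := hL'.eventually_isCompl hN.isContinuousLagrangianFamily_const h₂
  have hlag := hL.isLagrangian t₀
  have hlag' := hL'.isLagrangian t₀
  obtain ⟨K, g, hg, hi, hLg⟩ := hL.exists_map
  obtain ⟨K', g', hg', hi', hLg'⟩ := hL'.exists_map
  set S : X → (K' × N) →L[ℝ] E := fun t => (g' t ∘L K'.subtypeL).coprod N.subtypeL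
  have hSbij : ∀ t, IsCompl (L' t) N → Function.Bijective (S t) := by
    intro t ht
    rw [hLg', ← Submodule.map_id N] at ht
    exact (bijective_coprod_iff (g' := ContinuousLinearMap.id ℝ E) (hi' t)
      Function.injective_id).2 ht
  have hcont : Continuous S := by
    have h₂ : Continuous fun t => g' t ∘L K'.subtypeL := hg'.clm_comp continuous_const
    exact (ContinuousLinearMap.coprodEquivL ℝ).continuous.comp (h₂.prodMk continuous_const)
  have hinv : ContinuousAt (fun t => (S t).inverse) t₀ := by
    let e : (K' × N) ≃L[ℝ] E := (LinearEquiv.ofBijective _ (hSbij t₀ h₂)).toContinuousLinearEquiv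
    have he : (e : (K' × N) →L[ℝ] E) = S t₀ := rfl
    have := (contDiffAt_map_inverse (n := 0) e).continuousAt
    rw [he] at this
    exact this.comp hcont.continuousAt
  -- `a t z` is the point of `L' t` congruent to `g t z` modulo `N`.
  let a : X → K →L[ℝ] E := fun t => (g' t ∘L K'.subtypeL ∘L ContinuousLinearMap.fst ℝ K' N) ∘L
    ((S t).inverse ∘L (g t ∘L K.subtypeL))
  have hacont : ContinuousAt a t₀ :=
    (hg'.clm_comp continuous_const).continuousAt.clm_comp
      (hinv.clm_comp (hg.clm_comp continuous_const).continuousAt)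
  have ha' : ∀ t z, a t z ∈ L' t := fun t z => by
    rw [hLg']
    exact ⟨_, ((S t).inverse (g t z)).1.2, rfl⟩
  have haN : ∀ t, IsCompl (L' t) N → ∀ z, a t z - g t z ∈ N := by
    intro t ht z
    let e : (K' × N) ≃L[ℝ] E := (LinearEquiv.ofBijective _ (hSbij t ht)).toContinuousLinearEquiv
    have he : (e : (K' × N) →L[ℝ] E) = S t := rfl
    have h₁ : S t ((S t).inverse (g t z)) = g t z := by
      rw [← he, ContinuousLinearMap.inverse_equiv]
      exact e.apply_symm_apply _
    have h₂ : a t z + (((S t).inverse (g t z)).2 : E) = g t z := h₁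
    rw [← h₂, sub_add_cancel_left]
    exact N.neg_mem (Subtype.mem _)
  let B : X → LinearMap.BilinForm ℝ K := fun t =>
    σ.compl₁₂ (a t : K →ₗ[ℝ] E) ((g t : E →ₗ[ℝ] E) ∘ₗ K.subtype)
  have hB : ∀ t, IsCompl (L' t) N → chartSign σ N (L t) (L' t) = formSign (B t) := by
    intro t ht
    have hLt := hLg t
    refine chartSign_eq_formSign halt ht
      ((Submodule.equivMapOfInjective (g t : E →ₗ[ℝ] E) (hi t) K).trans
        (LinearEquiv.ofEq _ _ hLt.symm)) (a t) (ha' t) ?_ (B t) ?_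
    · exact haN t ht
    · exact fun z => rfl
  have hloc : ∀ᶠ t in 𝓝 t₀, formSign (B t) = formSign (B t₀) := by
    have hgL : ∀ z : K, g t₀ z ∈ L t₀ := fun z => by rw [hLg]; exact ⟨z, z.2, rfl⟩
    refine eventually_formSign_eq (fun z => ?_) (fun x y => ?_) (fun x hx => ?_)
    · have c₁ : ContinuousAt (fun p : X × K => a p.1 p.2) (t₀, z) :=
        (ContinuousAt.comp (f := Prod.fst) (x := (t₀, z)) hacont continuousAt_fst).clm_apply
          continuousAt_snd
      have c₂ : ContinuousAt (fun p : X × K => g p.1 p.2) (t₀, z) :=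
        ((hg.comp continuous_fst).clm_apply
          (continuous_subtype_val.comp continuous_snd)).continuousAt
      exact (continuous_bilinForm σ).continuousAt.comp (c₁.prodMk c₂)
    · change σ (a t₀ x) (g t₀ y) = σ (a t₀ y) (g t₀ x)
      have e₁ := hN.isotropic _ (haN t₀ h₂ x) _ (haN t₀ h₂ y)
      have e₂ := hlag'.isotropic _ (ha' t₀ x) _ (ha' t₀ y)
      have e₃ := hlag.isotropic _ (hgL x) _ (hgL y)
      have e₄ := halt.neg_eq (a t₀ y) (g t₀ x)
      simp only [map_sub, LinearMap.sub_apply] at e₁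
      linarith
    · have e₁ : a t₀ x ∈ L t₀ := hlag.mem_of_forall hnd fun y hy => by
        rw [hLg] at hy
        obtain ⟨k, hk, rfl⟩ := hy
        have : σ (a t₀ x) (g t₀ k) = 0 := hx ⟨k, hk⟩
        rw [← halt.neg_eq]
        simpa using this
      have e₂ : a t₀ x = 0 := Submodule.disjoint_def.1 h.disjoint _ e₁ (ha' t₀ x)
      have e₃ : g t₀ x = 0 := by
        refine Submodule.disjoint_def.1 h₁.disjoint _ (hgL x) ?_
        simpa [e₂] using haN t₀ h₂ x
      exact Subtype.ext (hi t₀ (e₃.trans (map_zero _).symm))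
  filter_upwards [hev, hloc] with t ht₁ ht₂
  rw [hB t ht₁, hB t₀ h₂, ht₂]

/-- The chart signatures relative to a moving Lagrangian `M` and to a fixed one `N` differ by a
locally constant amount: by the cocycle property the difference is
`sign φ_{L',N}(M) + sign φ_{M,N}(L)`, and `M` is transverse to `L` and `L'`. -/
theorem IsContinuousLagrangianFamily.eventually_chartSign_sub_eq (halt : σ.IsAlt)
    (hnd : σ.Nondegenerate) {M : X → Submodule ℝ E} (hL : IsContinuousLagrangianFamily σ L)
    (hL' : IsContinuousLagrangianFamily σ L') (hM : IsContinuousLagrangianFamily σ M)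
    {N : Submodule ℝ E} (hN : IsLagrangian σ N) (h₁ : IsCompl (L t₀) (M t₀))
    (h₂ : IsCompl (L' t₀) (M t₀)) (hLN : IsCompl (L t₀) N) (hL'N : IsCompl (L' t₀) N)
    (hMN : IsCompl (M t₀) N) :
    ∀ᶠ t in 𝓝 t₀, chartSign σ (M t) (L t) (L' t) - chartSign σ N (L t) (L' t)
      = chartSign σ (M t₀) (L t₀) (L' t₀) - chartSign σ N (L t₀) (L' t₀) := by
  have hNc : IsContinuousLagrangianFamily σ fun _ : X => N := hN.isContinuousLagrangianFamily_const
  have key : ∀ t, IsCompl (L' t) (M t) → IsCompl (L t) N → IsCompl (L' t) N → IsCompl (M t) N →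
      chartSign σ (M t) (L t) (L' t) - chartSign σ N (L t) (L' t)
        = chartSign σ N (L' t) (M t) + chartSign σ N (M t) (L t) := by
    intro t h h' h'' h'''
    rw [← kashiwaraIndex_eq_chartSign halt (hM.isLagrangian t).isotropic
      (hL'.isLagrangian t).isotropic h, kashiwaraIndex_eq_add halt hN.isotropic
      (hL.isLagrangian t).isotropic (hL'.isLagrangian t).isotropic (hM.isLagrangian t).isotropic
      h' h'' h''']
    ring
  filter_upwards [hL'.eventually_isCompl hM h₂, hL.eventually_isCompl hNc hLN,
    hL'.eventually_isCompl hNc hL'N, hM.eventually_isCompl hNc hMN,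
    hL'.eventually_chartSign_eq halt hnd hM hN h₂ hL'N hMN,
    hM.eventually_chartSign_eq halt hnd hL hN h₁.symm hMN hLN] with t e₁ e₂ e₃ e₄ e₅ e₆
  rw [key t e₁ e₂ e₃ e₄, key t₀ h₂ hLN hL'N hMN, e₅, e₆]

/-- The chart signatures relative to two fixed Lagrangians differ by a locally constant amount on
the common domain of the charts. -/
theorem IsContinuousLagrangianFamily.eventually_chartSign_sub_chartSign_eq (halt : σ.IsAlt)
    (hnd : σ.Nondegenerate) (hL : IsContinuousLagrangianFamily σ L) {Δ M M' : Submodule ℝ E}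
    (hΔ : IsLagrangian σ Δ) (hM : IsLagrangian σ M) (hM' : IsLagrangian σ M')
    (hΔM : IsCompl Δ M) (hΔM' : IsCompl Δ M') (h : IsCompl (L t₀) M) (h' : IsCompl (L t₀) M') :
    ∀ᶠ t in 𝓝 t₀, chartSign σ M Δ (L t) - chartSign σ M' Δ (L t)
      = chartSign σ M Δ (L t₀) - chartSign σ M' Δ (L t₀) := by
  obtain ⟨N, hN, hcN⟩ := exists_isLagrangian_isCompl hnd halt (L := ![Δ, L t₀, M, M']) (by
    intro i
    fin_cases i
    exacts [hΔ, hL.isLagrangian t₀, hM, hM'])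
  have hΔc : IsContinuousLagrangianFamily σ fun _ : X => Δ := hΔ.isContinuousLagrangianFamily_const
  filter_upwards [hΔc.eventually_chartSign_sub_eq (t₀ := t₀) halt hnd hL
      hM.isContinuousLagrangianFamily_const hN hΔM h (hcN 0) (hcN 1) (hcN 2),
    hΔc.eventually_chartSign_sub_eq (t₀ := t₀) halt hnd hL
      hM'.isContinuousLagrangianFamily_const hN hΔM' h' (hcN 0) (hcN 1) (hcN 3)] with t e₁ e₂
  linarith

end Families

/-! ### Primitives of the Maslov index -/

/-- A primitive of the Maslov index of `γ` relative to `Δ`: a function on the parameter space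
whose difference with `½ sign φ_{Δ,M}(γ)` is locally constant on the domain of each chart. The
Maslov index of a path is the increment of such a function. -/
def IsMaslovPrimitive {X E : Type*} [TopologicalSpace X] [AddCommGroup E] [Module ℝ E]
    (σ : LinearMap.BilinForm ℝ E) (Δ : Submodule ℝ E) (γ : X → Submodule ℝ E) (F : X → ℝ) : Prop :=
  ∀ (t₀ : X) (M : Submodule ℝ E), IsLagrangian σ M → IsCompl Δ M → IsCompl (γ t₀) M →
    ∀ᶠ t in 𝓝 t₀, F t - (1 / 2 : ℝ) * chartSign σ M Δ (γ t)
      = F t₀ - (1 / 2 : ℝ) * chartSign σ M Δ (γ t₀)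

theorem Fin.sum_univ_succ_sub_castSucc {k : ℕ} (f : Fin (k + 1) → ℝ) :
    ∑ i : Fin k, (f i.succ - f i.castSucc) = f (Fin.last k) - f 0 := by
  induction k with
  | zero => simp
  | succ k ih =>
    rw [Fin.sum_univ_castSucc]
    have := ih fun i => f i.castSucc
    simp only [Fin.castSucc_zero] at this
    simp only [Fin.succ_castSucc, this, Fin.succ_last]
    ring

section Primitive

variable {E : Type*}

/-- A primitive computes the index from any admissible subdivision. -/
theorem HasMaslovIndex.eq_sub [AddCommGroup E] [Module ℝ E] {σ : LinearMap.BilinForm ℝ E}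
    {L₀ : LagrangianGrassmannian σ} {γ : unitInterval → LagrangianGrassmannian σ} {r : ℝ}
    (h : HasMaslovIndex σ L₀ γ r) {F : unitInterval → ℝ}
    (hF : IsMaslovPrimitive σ L₀.1 (fun t => (γ t).1) F) : r = F 1 - F 0 := by
  obtain ⟨k, t, M, ht, ht0, ht1, hLM, hM, rfl⟩ := h
  rw [← ht0, ← ht1, ← Fin.sum_univ_succ_sub_castSucc fun i => F (t i)]
  refine Finset.sum_congr rfl fun i _ => ?_
  have hle : t i.castSucc ≤ t i.succ := ht i.castSucc_lt_succ.le
  simp only [← chartSign_of_isCompl]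
  have := isPreconnected_Icc.induction₂ (s := Set.Icc (t i.castSucc) (t i.succ))
    (fun a b => F a - (1 / 2 : ℝ) * chartSign σ (M i).1 L₀.1 (γ a).1
      = F b - (1 / 2 : ℝ) * chartSign σ (M i).1 L₀.1 (γ b).1)
    (fun s hs => mem_nhdsWithin_of_mem_nhds
      ((hF s (M i).1 (M i).2 (hLM i) (hM i s hs)).mono fun _ h => h.symm))
    (fun _ _ _ _ _ _ h₁ h₂ => h₁.trans h₂) (fun _ _ _ _ h => h.symm)
    (Set.left_mem_Icc.2 hle) (Set.right_mem_Icc.2 hle)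
  linarith

variable [NormedAddCommGroup E] [NormedSpace ℝ E] [FiniteDimensional ℝ E]
  {σ : LinearMap.BilinForm ℝ E} {L₀ : LagrangianGrassmannian σ}
  {γ : unitInterval → LagrangianGrassmannian σ}

/-- A continuous path has a subdivision adapted to charts. -/
theorem IsContinuousLagrangianFamily.exists_hasMaslovIndex (halt : σ.IsAlt)
    (hnd : σ.Nondegenerate) (hγ : IsContinuousLagrangianFamily σ fun t => (γ t).1) :
    ∃ r, HasMaslovIndex σ L₀ γ r := by
  let c : {M : LagrangianGrassmannian σ // IsCompl L₀.1 M.1} → Set unitInterval :=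
    fun M => {t | IsCompl (γ t).1 M.1.1}
  obtain ⟨t, ht0, ht, ⟨n, hn⟩, hc⟩ := exists_monotone_Icc_subset_open_cover_unitInterval (c := c)
    (fun M => isOpen_iff_eventually.2 fun s hs =>
      hγ.eventually_isCompl M.1.2.isContinuousLagrangianFamily_const hs)
    (fun s _ => by
      obtain ⟨N, hN, hcN⟩ := exists_isLagrangian_isCompl hnd halt (L := ![L₀.1, (γ s).1]) (by
        intro i
        fin_cases i
        exacts [L₀.2, (γ s).2])
      exact Set.mem_iUnion.2 ⟨⟨⟨N, hN⟩, hcN 0⟩, hcN 1⟩)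
  choose M hM using hc
  exact ⟨_, n, fun i => t i, fun i => (M i).1, fun i j hij => ht hij, ht0, hn n le_rfl,
    fun i => (M i).2, fun i s hs => hM i hs, rfl⟩

/-- A continuous path has a primitive: the contribution of each interval of an adapted subdivision
is cut off at `t`. -/
theorem IsContinuousLagrangianFamily.exists_isMaslovPrimitive (halt : σ.IsAlt)
    (hnd : σ.Nondegenerate) (hγ : IsContinuousLagrangianFamily σ fun t => (γ t).1)
    (L₀ : LagrangianGrassmannian σ) :
    ∃ F, IsMaslovPrimitive σ L₀.1 (fun t => (γ t).1) F := by
  obtain ⟨r, k, t, M, ht, ht0, ht1, hLM, hM, -⟩ := hγ.exists_hasMaslovIndex (L₀ := L₀) halt hnd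
  refine ⟨fun s => ∑ i : Fin k,
    ((1 / 2 : ℝ) * chartSign σ (M i).1 L₀.1 (γ (min s (t i.succ))).1
      - (1 / 2 : ℝ) * chartSign σ (M i).1 L₀.1 (γ (min s (t i.castSucc))).1), ?_⟩
  intro s₀ N hN hLN hγN
  -- the difference of the chart signatures relative to `M i` and `N`
  let d : Fin k → unitInterval → ℝ := fun i s =>
    (1 / 2 : ℝ) * chartSign σ (M i).1 L₀.1 (γ s).1 - (1 / 2 : ℝ) * chartSign σ N L₀.1 (γ s).1
  have key : ∀ i, ∀ᶠ s in 𝓝 s₀, d i (min s (t i.succ)) - d i (min s (t i.castSucc))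
      = d i (min s₀ (t i.succ)) - d i (min s₀ (t i.castSucc)) := by
    intro i
    have hle : t i.castSucc ≤ t i.succ := ht i.castSucc_lt_succ.le
    rcases lt_or_ge s₀ (t i.castSucc) with hlt | hge
    · filter_upwards [gt_mem_nhds hlt] with s hs
      rw [min_eq_left hs.le, min_eq_left (hs.le.trans hle), min_eq_left hlt.le,
        min_eq_left (hlt.le.trans hle), sub_self, sub_self]
    rcases lt_or_ge (t i.succ) s₀ with hgt | hle'
    · filter_upwards [lt_mem_nhds hgt] with s hs
      rw [min_eq_right hs.le, min_eq_right (hle.trans hs.le), min_eq_right hgt.le,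
        min_eq_right (hle.trans hgt.le)]
    have hd : ∀ᶠ s in 𝓝 s₀, d i s = d i s₀ := by
      filter_upwards [hγ.eventually_chartSign_sub_chartSign_eq halt hnd L₀.2 (M i).2 hN (hLM i) hLN
        (hM i s₀ ⟨hge, hle'⟩) hγN] with s hs
      have : ((chartSign σ (M i).1 L₀.1 (γ s).1 - chartSign σ N L₀.1 (γ s).1 : ℤ) : ℝ)
          = (chartSign σ (M i).1 L₀.1 (γ s₀).1 - chartSign σ N L₀.1 (γ s₀).1 : ℤ) := by rw [hs]
      push_cast at this
      simp only [d]
      linarith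
    have htend : Tendsto (fun s => min s (t i.succ)) (𝓝 s₀) (𝓝 s₀) := by
      have : ContinuousAt (fun s => min s (t i.succ)) s₀ :=
        (continuous_id.min continuous_const).continuousAt
      rwa [ContinuousAt, min_eq_left hle'] at this
    rcases hge.lt_or_eq with hlt | heq
    · filter_upwards [htend.eventually hd, lt_mem_nhds hlt] with s hs hs'
      rw [hs, min_eq_left hle', min_eq_right hs'.le, min_eq_right hge]
    · filter_upwards [htend.eventually hd] with s hs
      rw [hs, min_eq_left hle', min_eq_right hge, heq, sub_self]
      rcases le_total s₀ s with h | h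
      · rw [min_eq_right h, sub_self]
      · rw [min_eq_left (h.trans hle')] at hs
        rw [min_eq_left h, hs, sub_self]
  have tele : ∀ s, ∑ i : Fin k, ((1 / 2 : ℝ) * chartSign σ N L₀.1 (γ (min s (t i.succ))).1
      - (1 / 2 : ℝ) * chartSign σ N L₀.1 (γ (min s (t i.castSucc))).1)
      = (1 / 2 : ℝ) * chartSign σ N L₀.1 (γ s).1 - (1 / 2 : ℝ) * chartSign σ N L₀.1 (γ 0).1 := by
    intro s
    rw [Fin.sum_univ_succ_sub_castSucc fun i =>
      (1 / 2 : ℝ) * (chartSign σ N L₀.1 (γ (min s (t i))).1 : ℝ), ht0, ht1,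
      min_eq_left unitInterval.le_one', min_eq_right unitInterval.nonneg']
  have tele' : ∀ s, ∑ i : Fin k, ((1 / 2 : ℝ) * chartSign σ (M i).1 L₀.1 (γ (min s (t i.succ))).1
      - (1 / 2 : ℝ) * chartSign σ (M i).1 L₀.1 (γ (min s (t i.castSucc))).1)
      - (1 / 2 : ℝ) * chartSign σ N L₀.1 (γ s).1
      = ∑ i : Fin k, (d i (min s (t i.succ)) - d i (min s (t i.castSucc)))
        - (1 / 2 : ℝ) * chartSign σ N L₀.1 (γ 0).1 := by
    intro s
    have h := tele s
    have e : ∑ i : Fin k, (d i (min s (t i.succ)) - d i (min s (t i.castSucc)))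
        = ∑ i : Fin k, ((1 / 2 : ℝ) * chartSign σ (M i).1 L₀.1 (γ (min s (t i.succ))).1
          - (1 / 2 : ℝ) * chartSign σ (M i).1 L₀.1 (γ (min s (t i.castSucc))).1)
        - ∑ i : Fin k, ((1 / 2 : ℝ) * chartSign σ N L₀.1 (γ (min s (t i.succ))).1
          - (1 / 2 : ℝ) * chartSign σ N L₀.1 (γ (min s (t i.castSucc))).1) := by
      rw [← Finset.sum_sub_distrib]
      refine Finset.sum_congr rfl fun i _ => ?_
      simp only [d]
      ring
    rw [e, h]
    ring
  filter_upwards [eventually_all.2 key] with s hs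
  rw [tele', tele']
  simp only [hs]

/-- The Maslov index of a continuous path is the increment of any primitive. -/
theorem IsMaslovPrimitive.maslovIndex_eq (halt : σ.IsAlt) (hnd : σ.Nondegenerate)
    (hγ : IsContinuousLagrangianFamily σ fun t => (γ t).1) {F : unitInterval → ℝ}
    (hF : IsMaslovPrimitive σ L₀.1 (fun t => (γ t).1) F) : maslovIndex σ L₀ γ = F 1 - F 0 := by
  have h := hγ.exists_hasMaslovIndex (L₀ := L₀) halt hnd
  rw [maslovIndex, dif_pos h]
  exact h.choose_spec.eq_sub hF

end Primitive

/-! ### Symplectic invariance -/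

section Invariance

variable {E : Type*} [AddCommGroup E] [Module ℝ E] {σ : LinearMap.BilinForm ℝ E}

theorem IsCompl.map_linearEquiv {p q : Submodule ℝ E} (h : IsCompl p q) (e : E ≃ₗ[ℝ] E) :
    IsCompl (p.map (e : E →ₗ[ℝ] E)) (q.map (e : E →ₗ[ℝ] E)) :=
  (Submodule.orderIsoMapComap e).isCompl h

theorem IsLagrangian.map_linearEquiv {L : Submodule ℝ E} (hL : IsLagrangian σ L) (e : E ≃ₗ[ℝ] E)
    (he : ∀ x y, σ (e x) (e y) = σ x y) : IsLagrangian σ (L.map (e : E →ₗ[ℝ] E)) where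
  isotropic := by
    rintro _ ⟨x, hx, rfl⟩ _ ⟨y, hy, rfl⟩
    exact (he x y).trans (hL.isotropic x hx y hy)
  finrank_eq := by
    rw [← hL.finrank_eq]
    congr 1
    exact LinearEquiv.finrank_map_eq e L

/-- Chart signatures are invariant under symplectic maps. -/
theorem chartSign_map_linearEquiv (hσ : σ.IsAlt) {N L₁ L₂ : Submodule ℝ E} (h : IsCompl L₂ N)
    (e : E ≃ₗ[ℝ] E) (he : ∀ x y, σ (e x) (e y) = σ x y) :
    chartSign σ (N.map (e : E →ₗ[ℝ] E)) (L₁.map (e : E →ₗ[ℝ] E)) (L₂.map (e : E →ₗ[ℝ] E))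
      = chartSign σ N L₁ L₂ := by
  let P : L₁ →ₗ[ℝ] E := L₂.subtype ∘ₗ L₂.projectionOnto N h ∘ₗ L₁.subtype
  have hP : ∀ x, P x ∈ L₂ := fun x => Subtype.mem _
  have hPN : ∀ x : L₁, P x - x ∈ N := fun x => by
    have := Submodule.projection_add_projection_eq_self h (x : E)
    rw [← this]
    change (L₂.projectionOnto N h x : E) - (L₂.projectionOnto N h x + N.projectionOnto L₂ _ x) ∈ N
    rw [sub_add_cancel_left]
    exact N.neg_mem (Subtype.mem _)
  rw [chartSign_eq_formSign hσ h (LinearEquiv.refl ℝ L₁) P hP hPN (σ.compl₁₂ P L₁.subtype)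
    fun z => rfl]
  refine chartSign_eq_formSign hσ (h.map_linearEquiv e)
    (Submodule.equivMapOfInjective (e : E →ₗ[ℝ] E) e.injective L₁) (fun z => e (P z))
    (fun z => ⟨P z, hP z, rfl⟩) (fun z => ⟨P z - z, hPN z, map_sub e _ _⟩) _ fun z => ?_
  exact (he _ _).symm

end Invariance

/-! ### Graphs of symplectic maps and the product formula -/

section DoubleForm

variable {V : Type*} [AddCommGroup V] [Module ℝ V] {ω : LinearMap.BilinForm ℝ V}

theorem doubleForm_apply (p q : V × V) : doubleForm ω p q = ω p.1 q.1 - ω p.2 q.2 := rfl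

theorem isAlt_doubleForm (hω : ω.IsAlt) : (doubleForm ω).IsAlt := fun p => by
  rw [doubleForm_apply, hω.self_eq_zero, hω.self_eq_zero, sub_zero]

theorem nondegenerate_doubleForm (hω : ω.Nondegenerate) : (doubleForm ω).Nondegenerate := by
  constructor
  · rintro ⟨x, y⟩ h
    have h₁ : x = 0 := hω.1 x fun z => by simpa [doubleForm_apply] using h (z, 0)
    have h₂ : y = 0 := hω.1 y fun z => by simpa [doubleForm_apply] using h (0, z)
    rw [h₁, h₂, Prod.mk_zero_zero]
  · rintro ⟨x, y⟩ h
    have h₁ : x = 0 := hω.2 x fun z => by simpa [doubleForm_apply] using h (z, 0)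
    have h₂ : y = 0 := hω.2 y fun z => by simpa [doubleForm_apply] using h (0, z)
    rw [h₁, h₂, Prod.mk_zero_zero]

end DoubleForm

section Graphs

variable {V : Type*} [NormedAddCommGroup V] [NormedSpace ℝ V] {ω : LinearMap.BilinForm ℝ V}

theorem spMap_mul (A B : Sp ω) : spMap (A * B) = spMap A * spMap B := rfl

theorem continuous_spMap : Continuous (spMap : Sp ω → V →L[ℝ] V) :=
  Units.continuous_val.comp continuous_subtype_val

/-- The automorphism `Id × A` of `V ⊕ V`. -/
noncomputable def idProd (A : Sp ω) : (V × V) ≃L[ℝ] (V × V) :=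
  (ContinuousLinearEquiv.refl ℝ V).prodCongr (ContinuousLinearEquiv.unitsEquiv ℝ V A.1)

theorem idProd_apply (A : Sp ω) (p : V × V) : idProd A p = (p.1, spMap A p.2) := rfl

theorem doubleForm_idProd (A : Sp ω) (p q : V × V) :
    doubleForm ω (idProd A p) (idProd A q) = doubleForm ω p q := by
  simp only [doubleForm_apply, idProd_apply]
  rw [show ω (spMap A p.2) (spMap A q.2) = ω p.2 q.2 from A.2 _ _]

theorem isContinuousLagrangianFamily_map_idProd {X : Type*} [TopologicalSpace X] {A : X → Sp ω}
    (hA : Continuous A) {K : Submodule ℝ (V × V)} (hK : IsLagrangian (doubleForm ω) K) :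
    IsContinuousLagrangianFamily (doubleForm ω) fun t =>
      K.map ((idProd (A t)).toLinearEquiv : V × V →ₗ[ℝ] V × V) where
  exists_map := by
    refine ⟨K, fun t => (idProd (A t) : V × V →L[ℝ] V × V), ?_, fun t => (idProd (A t)).injective,
      fun t => rfl⟩
    have h : Continuous fun t => (ContinuousLinearMap.id ℝ V).prodMap (spMap (A t)) :=
      continuous_const.prod_mapL ℝ (continuous_spMap.comp hA)
    exact h
  isLagrangian t := hK.map_linearEquiv _ (doubleForm_idProd (A t))

variable [FiniteDimensional ℝ V]

theorem mem_Gr {A : Sp ω} {p : V × V} : p ∈ (Gr A).1 ↔ p.2 = spMap A p.1 :=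
  LinearMap.mem_graph_iff _ p

theorem Gr_mul (A B : Sp ω) :
    (Gr (A * B)).1 = (Gr B).1.map ((idProd A).toLinearEquiv : V × V →ₗ[ℝ] V × V) := by
  ext ⟨x, y⟩
  rw [mem_Gr]
  constructor
  · intro h
    refine ⟨(x, spMap B x), mem_Gr.2 rfl, ?_⟩
    exact Prod.ext rfl h.symm
  · rintro ⟨⟨a, b⟩, hp, he⟩
    have hb : b = spMap B a := mem_Gr.1 hp
    have h₁ : a = x := congrArg Prod.fst he
    have h₂ : spMap A b = y := congrArg Prod.snd he
    simp only
    rw [← h₂, hb, h₁]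
    rfl

theorem isContinuousLagrangianFamily_Gr {X : Type*} [TopologicalSpace X] {A : X → Sp ω}
    (hA : Continuous A) : IsContinuousLagrangianFamily (doubleForm ω) fun t => (Gr (A t)).1 := by
  have h := isContinuousLagrangianFamily_map_idProd hA (Gr (1 : Sp ω)).2
  simpa only [← Gr_mul, mul_one] using h

/-- If `F₁`, `F₂` are primitives of the Maslov index for the graphs of `A`, `B`, then a primitive
for the graphs of `AB` is obtained by adding half the Kashiwara index of `(Δ, Gr A, Gr AB)` with a
minus sign. -/
theorem IsMaslovPrimitive.mul {X : Type*} [TopologicalSpace X] (hω : ω.IsAlt)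
    (hnd : ω.Nondegenerate) {A B : X → Sp ω} (hA : Continuous A) (hB : Continuous B)
    {F₁ F₂ : X → ℝ}
    (h₁ : IsMaslovPrimitive (doubleForm ω) (Gr (1 : Sp ω)).1 (fun t => (Gr (A t)).1) F₁)
    (h₂ : IsMaslovPrimitive (doubleForm ω) (Gr (1 : Sp ω)).1 (fun t => (Gr (B t)).1) F₂) :
    IsMaslovPrimitive (doubleForm ω) (Gr (1 : Sp ω)).1 (fun t => (Gr (A t * B t)).1) fun t =>
      F₁ t + F₂ t - (1 / 2 : ℝ) * kashiwaraIndex (doubleForm ω) (Gr (1 : Sp ω)).1 (Gr (A t)).1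
        (Gr (A t * B t)).1 := by
  intro t₀ M₀ hM₀ hΔM₀ hABM₀
  set σ := doubleForm ω
  set Δ := (Gr (1 : Sp ω)).1
  have hΔ : IsLagrangian σ Δ := (Gr (1 : Sp ω)).2
  have halt : σ.IsAlt := isAlt_doubleForm hω
  have hσ : σ.Nondegenerate := nondegenerate_doubleForm hnd
  have cΔ : IsContinuousLagrangianFamily σ fun _ : X => Δ := hΔ.isContinuousLagrangianFamily_const
  have cA := isContinuousLagrangianFamily_Gr hA
  have cB := isContinuousLagrangianFamily_Gr hB
  have cAB : IsContinuousLagrangianFamily σ fun t => (Gr (A t * B t)).1 :=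
    isContinuousLagrangianFamily_Gr (hA.mul hB)
  -- a chart containing `Δ`, `Gr A` and `Gr AB` near `t₀`
  obtain ⟨M, hM, hcM⟩ := exists_isLagrangian_isCompl hσ halt
    (L := ![Δ, (Gr (A t₀)).1, (Gr (A t₀ * B t₀)).1]) (by
      intro i
      fin_cases i
      exacts [hΔ, (Gr (A t₀)).2, (Gr (A t₀ * B t₀)).2])
  have hΔM : IsCompl Δ M := hcM 0
  have hAM : IsCompl (Gr (A t₀)).1 M := hcM 1
  have hABM : IsCompl (Gr (A t₀ * B t₀)).1 M := hcM 2
  have cM : IsContinuousLagrangianFamily σ fun _ : X => M := hM.isContinuousLagrangianFamily_const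
  -- `(Id × A)⁻¹` takes `(Gr A, Gr AB, M)` to `(Δ, Gr B, M')`
  set M' : X → Submodule ℝ (V × V) := fun t =>
    M.map ((idProd (A t)⁻¹).toLinearEquiv : V × V →ₗ[ℝ] V × V)
  have cM' : IsContinuousLagrangianFamily σ M' :=
    isContinuousLagrangianFamily_map_idProd hA.inv hM
  have mapA : ∀ t, (Gr (A t)).1.map ((idProd (A t)⁻¹).toLinearEquiv : V × V →ₗ[ℝ] V × V) = Δ := by
    intro t
    rw [← Gr_mul, inv_mul_cancel]
  have mapAB : ∀ t, (Gr (A t * B t)).1.map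
      ((idProd (A t)⁻¹).toLinearEquiv : V × V →ₗ[ℝ] V × V) = (Gr (B t)).1 := by
    intro t
    rw [← Gr_mul, inv_mul_cancel_left]
  have hΔM' : IsCompl Δ (M' t₀) := by
    have := hAM.map_linearEquiv (idProd (A t₀)⁻¹).toLinearEquiv
    rwa [mapA] at this
  have hBM' : IsCompl (Gr (B t₀)).1 (M' t₀) := by
    have := hABM.map_linearEquiv (idProd (A t₀)⁻¹).toLinearEquiv
    rwa [mapAB] at this
  have hD : ∀ t, IsCompl (Gr (A t * B t)).1 M →
      chartSign σ M (Gr (A t)).1 (Gr (A t * B t)).1 = chartSign σ (M' t) Δ (Gr (B t)).1 := by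
    intro t ht
    have := chartSign_map_linearEquiv (L₁ := (Gr (A t)).1) halt ht
      (idProd (A t)⁻¹).toLinearEquiv (doubleForm_idProd (A t)⁻¹)
    rw [mapA, mapAB] at this
    exact this.symm
  obtain ⟨N, hN, hcN⟩ := exists_isLagrangian_isCompl hσ halt
    (L := ![Δ, (Gr (B t₀)).1, M' t₀]) (by
      intro i
      fin_cases i
      exacts [hΔ, (Gr (B t₀)).2, cM'.isLagrangian t₀])
  have hτ : ∀ t, IsCompl (Gr (A t)).1 M → IsCompl (Gr (A t * B t)).1 M →
      kashiwaraIndex σ Δ (Gr (A t)).1 (Gr (A t * B t)).1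
        = chartSign σ M Δ (Gr (A t)).1 + chartSign σ (M' t) Δ (Gr (B t)).1
          - chartSign σ M Δ (Gr (A t * B t)).1 := by
    intro t hA hAB
    rw [kashiwaraIndex_eq_add halt hM.isotropic hΔ.isotropic (Gr (A t)).2.isotropic
      (Gr (A t * B t)).2.isotropic hΔM hA hAB, hD t hAB, chartSign_swap halt hΔM hAB]
    ring
  filter_upwards [h₁ t₀ M hM hΔM hAM, h₂ t₀ N hN (hcN 0) (hcN 1),
    cAB.eventually_chartSign_sub_chartSign_eq halt hσ hΔ hM₀ hM hΔM₀ hΔM hABM₀ hABM,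
    cΔ.eventually_chartSign_sub_eq halt hσ cB cM' hN hΔM' hBM' (hcN 0) (hcN 1) (hcN 2),
    cA.eventually_isCompl cM hAM, cAB.eventually_isCompl cM hABM] with t e₁ e₂ e₃ e₄ tA tAB
  rw [hτ t tA tAB, hτ t₀ hAM hABM]
  have e₃' := congrArg (Int.cast : ℤ → ℝ) e₃
  have e₄' := congrArg (Int.cast : ℤ → ℝ) e₄
  push_cast at e₃' e₄' ⊢
  linarith only [e₁, e₂, e₃', e₄']

theorem isCompl_Gr_one_Gr {A : Sp ω} (hA : IsUnit (1 - spMap A)) :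
    IsCompl (Gr (1 : Sp ω)).1 (Gr A).1 := by
  refine (Submodule.isCompl_iff_disjoint _ _ ?_).2 (Submodule.disjoint_def.2 ?_)
  · have e₁ := (Gr (1 : Sp ω)).2.finrank_eq
    have e₂ := (Gr A).2.finrank_eq
    omega
  · rintro ⟨x, y⟩ h₁ h₂
    have e₁ : y = x := mem_Gr.1 h₁
    have e₂ : y = spMap A x := mem_Gr.1 h₂
    have h0 : (1 - spMap A) x = 0 := by
      change x - spMap A x = 0
      rw [← e₂, e₁, sub_self]
    have hx : x = 0 := by
      have := congrArg (fun T : V →L[ℝ] V => T x) (Ring.inverse_mul_cancel _ hA)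
      change Ring.inverse (1 - spMap A) ((1 - spMap A) x) = x at this
      rw [← this, h0, map_zero]
    rw [e₁, hx, Prod.mk_zero_zero]

end Graphs

/-! ### The Cayley transform at the endpoints -/

section Cayley

variable {V : Type*} [NormedAddCommGroup V] [InnerProductSpace ℝ V]
  {ω : LinearMap.BilinForm ℝ V}

/-- As `(Id + A)(Id - A)⁻¹ = 2(Id - A)⁻¹ - Id`, the form of the Cayley transform is
`ω(((Id - A)⁻¹ - ½)v, w)`. -/
theorem operatorForm_symplecticCayley {J : V →L[ℝ] V} (hωJ : ∀ v w : V, inner ℝ (J v) w = ω v w)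
    {A : V →L[ℝ] V} (hA : IsUnit (1 - A)) (v w : V) :
    inner ℝ (symplecticCayley J A v) w
      = ω (Ring.inverse (1 - A) v) w - (1 / 2 : ℝ) * ω v w := by
  have h : (1 + A) * Ring.inverse (1 - A) = (2 : ℝ) • Ring.inverse (1 - A) - 1 := by
    have := Ring.mul_inverse_cancel _ hA
    rw [sub_mul, one_mul] at this
    rw [add_mul, one_mul, two_smul, ← sub_sub_cancel (Ring.inverse (1 - A))
      (A * Ring.inverse (1 - A)), this]
    abel
  rw [symplecticCayley, mul_assoc, h]
  change inner ℝ ((1 / 2 : ℝ) • J ((2 : ℝ) • Ring.inverse (1 - A) v - v)) w = _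
  rw [← map_smul, hωJ, smul_sub, smul_smul]
  simp

variable [FiniteDimensional ℝ V]

/-- The Kashiwara index of `(Δ, Gr A, Gr AB)` is minus the signature of the sum of the Cayley
transforms. With `P = (Id - A)⁻¹` and `R = (Id - B)⁻¹`, parametrize `Gr AB` by
`u ↦ (Ru, A(R - Id)u)`; the point of `Δ` congruent to it modulo `Gr A` is
`((Id - P)u, (Id - P)u)`. -/
theorem kashiwaraIndex_Gr_eq_neg_formSign (hω : ω.IsAlt) {J : V →L[ℝ] V}
    (hωJ : ∀ v w : V, inner ℝ (J v) w = ω v w) {A B : Sp ω} (hA : IsUnit (1 - spMap A))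
    (hB : IsUnit (1 - spMap B)) :
    kashiwaraIndex (doubleForm ω) (Gr (1 : Sp ω)).1 (Gr A).1 (Gr (A * B)).1
      = -formSign (operatorForm
          (symplecticCayley J (spMap A) + symplecticCayley J (spMap B))) := by
  set P := Ring.inverse (1 - spMap A)
  set R := Ring.inverse (1 - spMap B)
  have hAP : ∀ u, spMap A (P u) = P u - u := fun u => by
    have := congrArg (fun T : V →L[ℝ] V => T u) (Ring.mul_inverse_cancel _ hA)
    change P u - spMap A (P u) = u at this
    exact eq_sub_of_add_eq' (sub_eq_iff_eq_add.1 this).symm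
  have hBR : ∀ u, spMap B (R u) = R u - u := fun u => by
    have := congrArg (fun T : V →L[ℝ] V => T u) (Ring.mul_inverse_cancel _ hB)
    change R u - spMap B (R u) = u at this
    exact eq_sub_of_add_eq' (sub_eq_iff_eq_add.1 this).symm
  have hRinv : ∀ x, R ((1 - spMap B) x) = x := fun x =>
    congrArg (fun T : V →L[ℝ] V => T x) (Ring.inverse_mul_cancel _ hB)
  have hRinv' : ∀ x, (1 - spMap B) (R x) = x := fun x =>
    congrArg (fun T : V →L[ℝ] V => T x) (Ring.mul_inverse_cancel _ hB)
  have hmem : ∀ u, (R u, spMap A (R u - u)) ∈ (Gr (A * B)).1 := fun u => by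
    rw [mem_Gr, spMap_mul]
    change spMap A (R u - u) = spMap A (spMap B (R u))
    rw [hBR]
  let a₁ : V ≃ₗ[ℝ] (Gr (A * B)).1 :=
    { toFun := fun u => ⟨(R u, spMap A (R u - u)), hmem u⟩
      invFun := fun p => (1 - spMap B) p.1.1
      map_add' := fun u v => by
        ext
        · simp
        · simp only [map_add, map_sub, Submodule.coe_add, Prod.snd_add]
          abel
      map_smul' := fun c u => by
        ext
        · simp
        · simp [smul_sub]
      left_inv := fun u => hRinv' u
      right_inv := fun p => by
        have hp : p.1.2 = spMap A (spMap B p.1.1) := mem_Gr.1 p.2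
        refine Subtype.ext (Prod.ext (hRinv _) ?_)
        rw [hp]
        change spMap A (R ((1 - spMap B) p.1.1) - (1 - spMap B) p.1.1) = _
        rw [hRinv]
        change spMap A (p.1.1 - (p.1.1 - spMap B p.1.1)) = _
        rw [sub_sub_cancel] }
  rw [kashiwaraIndex_rotate, kashiwaraIndex_rotate, kashiwaraIndex_eq_chartSign
    (isAlt_doubleForm hω) (Gr A).2.isotropic (Gr (1 : Sp ω)).2.isotropic (isCompl_Gr_one_Gr hA),
    ← formSign_neg]
  refine chartSign_eq_formSign (isAlt_doubleForm hω) (isCompl_Gr_one_Gr hA) a₁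
    (fun u => (u - P u, u - P u)) (fun u => mem_Gr.2 rfl) (fun u => ?_) _ fun u => ?_
  · rw [mem_Gr]
    change u - P u - spMap A (R u - u) = spMap A (u - P u - R u)
    simp only [map_sub, hAP]
    abel
  · change -inner ℝ ((symplecticCayley J (spMap A) + symplecticCayley J (spMap B)) u) u
      = ω (u - P u) (R u) - ω (u - P u) (spMap A (R u - u))
    have e₁ : u - P u = spMap A (-P u) := by rw [map_neg, hAP, neg_sub]
    have e₂ : ω (u - P u) (spMap A (R u - u)) = ω (-P u) (R u - u) := by
      rw [e₁]
      exact A.2 _ _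
    have e₃ := hω.neg_eq u (R u)
    have e₄ := hω.self_eq_zero u
    rw [e₂, add_apply, inner_add_left,
      operatorForm_symplecticCayley hωJ hA, operatorForm_symplecticCayley hωJ hB]
    simp only [map_sub, map_neg, LinearMap.sub_apply, LinearMap.neg_apply]
    linarith

/-- The increment of the primitive of the graphs of `Φ₁Φ₂` gives the product formula. -/
theorem conleyZehnder_mul (hω : ω.IsAlt) (hnd : ω.Nondegenerate) {J : V →L[ℝ] V}
    (hωJ : ∀ v w : V, inner ℝ (J v) w = ω v w) {Φ₁ Φ₂ : C(unitInterval, Sp ω)} (h₁ : Φ₁ 0 = 1)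
    (h₂ : Φ₂ 0 = 1) (hinv₁ : IsUnit (1 - spMap (Φ₁ 1))) (hinv₂ : IsUnit (1 - spMap (Φ₂ 1))) :
    conleyZehnder (Φ₁ * Φ₂) = conleyZehnder Φ₁ + conleyZehnder Φ₂
      + (1 / 2 : ℝ) * (formSign (operatorForm
          (symplecticCayley J (spMap (Φ₁ 1)) + symplecticCayley J (spMap (Φ₂ 1)))) : ℝ) := by
  have halt := isAlt_doubleForm hω
  have hσ := nondegenerate_doubleForm hnd
  have c₁ := isContinuousLagrangianFamily_Gr Φ₁.continuous
  have c₂ := isContinuousLagrangianFamily_Gr Φ₂.continuous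
  obtain ⟨F₁, hF₁⟩ := c₁.exists_isMaslovPrimitive halt hσ (Gr 1)
  obtain ⟨F₂, hF₂⟩ := c₂.exists_isMaslovPrimitive halt hσ (Gr 1)
  have hF := hF₁.mul hω hnd Φ₁.continuous Φ₂.continuous hF₂
  have e₁ : conleyZehnder Φ₁ = F₁ 1 - F₁ 0 := hF₁.maslovIndex_eq halt hσ c₁
  have e₂ : conleyZehnder Φ₂ = F₂ 1 - F₂ 0 := hF₂.maslovIndex_eq halt hσ c₂
  have e := hF.maslovIndex_eq (γ := fun t => Gr ((Φ₁ * Φ₂) t)) halt hσ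
    (isContinuousLagrangianFamily_Gr (Φ₁ * Φ₂).continuous)
  rw [h₁, h₂, mul_one, kashiwaraIndex_self halt,
    kashiwaraIndex_Gr_eq_neg_formSign hω hωJ hinv₁ hinv₂] at e
  rw [conleyZehnder, e, e₁, e₂]
  push_cast
  ring

end Cayley

theorem corollary3p5 {V : Type*} [NormedAddCommGroup V] [InnerProductSpace ℝ V]
    [FiniteDimensional ℝ V]
    (ω : LinearMap.BilinForm ℝ V) (hω_alt : ω.IsAlt) (hω_nondeg : ω.Nondegenerate)
    (J : V →L[ℝ] V) (hJ : J * J = -1) (hωJ : ∀ v w : V, inner ℝ (J v) w = ω v w)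
    (Φ₁ Φ₂ : C(unitInterval, Sp ω)) (h₁ : Φ₁ 0 = 1) (h₂ : Φ₂ 0 = 1)
    (hinv₁ : IsUnit (1 - spMap (Φ₁ 1))) (hinv₂ : IsUnit (1 - spMap (Φ₂ 1))) :
    conleyZehnder (Φ₁ * Φ₂) = conleyZehnder (Φ₂ * Φ₁) ∧
    conleyZehnder (Φ₁ * Φ₂) = conleyZehnder Φ₁ + conleyZehnder Φ₂
      + (1 / 2 : ℝ) * (formSign (operatorForm
          (symplecticCayley J (spMap (Φ₁ 1)) + symplecticCayley J (spMap (Φ₂ 1)))) : ℝ) := by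
  have h := conleyZehnder_mul hω_alt hω_nondeg hωJ h₁ h₂ hinv₁ hinv₂
  have h' := conleyZehnder_mul hω_alt hω_nondeg hωJ h₂ h₁ hinv₂ hinv₁
  refine ⟨?_, h⟩
  rw [h, h', add_comm (conleyZehnder Φ₁), add_comm (symplecticCayley J (spMap (Φ₁ 1)))]
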